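/- For $0<c<\tfrac12$ let $\Theta=\{(x,y,z): x>0,\ y>0,\ x^2+y^2+z^2=1,\ xy=c\}$; these are the loop level sets in the positive sector. Each is a closed orbit of the vector field $\Sigma(x,y,z)=(xz,-yz,-x^2+y^2)$, and its period is the time a flowline of $\Sigma$ takes to go exactly once around it. For each $L>\pi\sqrt2$ there is exactly one such loop level set $\Theta_L$ of period $L$. Let $(x_L,y_L,z_L,\underline b_L)$ be the solution of $$x'=-xz,\qquad y'=yz,\qquad z'=x^2-y^2,\qquad \underline b'=y-\underline b z$$ with $x_L(0)>y_L(0)>z_L(0)=\underline b_L(0)=0$ and $(x_L(0),y_L(0),0)\in\Theta_L$, and write $\dot{\underline b}_L(t)=\frac{\partial}{\partial L}\,\underline b_L(t)$ for the derivative in $L$ at fixed $t$. **Lemma 7.4 (Monotonicity).** There is $L_0$ such that for every $L>L_0$ the derivative $\dot{\underline b}_L(t)$ exists for all $t\in[L/2,L]$, and there is a point $t_L\in(L-1,L)$ such that $\dot{\underline b}_L(t)<0$ for $t\in[L/2,t_L)$ and $\dot{\underline b}_L(t)>0$ for $t\in(t_L,L]$. Moreover, $L\mapsto t_L$ is strictly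 increasing on $(L_0,\infty)$. -/

import Mathlib

namespace SolFlow

/-- The structure field of Sol, `Σ(x,y,z) = (xz, -yz, -x² + y²)`: the geodesic flow of Sol written in
a left-invariant frame. -/
def structureField (p : ℝ × ℝ × ℝ) : ℝ × ℝ × ℝ :=
  (p.1 * p.2.2, -(p.2.1 * p.2.2), -p.1 ^ 2 + p.2.1 ^ 2)

/-- A flowline: an integral curve, defined for all time, of the structure field. -/
def IsFlowline (γ : ℝ → ℝ × ℝ × ℝ) : Prop :=
  ∀ t : ℝ, HasDerivAt γ (structureField (γ t)) t

/-- The loop level sets in the positive sector: the level sets of `F(x,y,z) = xy` on the part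
`x, y > 0` of the unit sphere, with level strictly between `0` and the maximum `1/2` (at level `1/2`
the level set is the single equilibrium point `(1/√2, 1/√2, 0)`). -/
def IsLoopLevelSet (Θ : Set (ℝ × ℝ × ℝ)) : Prop :=
  ∃ c : ℝ, 0 < c ∧ c < 1 / 2 ∧
    Θ = {p | 0 < p.1 ∧ 0 < p.2.1 ∧ p.1 ^ 2 + p.2.1 ^ 2 + p.2.2 ^ 2 = 1 ∧ p.1 * p.2.1 = c}

/-- `Θ` has period `L`: the flowline through any point of `Θ` takes time exactly `L` to
return for the first time to its starting point. -/
def HasPeriod (Θ : Set (ℝ × ℝ × ℝ)) (L : ℝ) : Prop :=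
  ∀ p ∈ Θ, ∃ γ : ℝ → ℝ × ℝ × ℝ,
    IsFlowline γ ∧ γ 0 = p ∧ IsLeast {T : ℝ | 0 < T ∧ γ T = γ 0} L

/-- `(x, y, z, b)` solves the backward flow `x' = -xz`, `y' = yz`, `z' = x² - y²`, together with
`b' = y - bz`, with `x(0) > y(0) > z(0) = b(0) = 0` and with `(x(0), y(0), z(0))` in the loop level
set of period `L` in the positive sector. -/
structure IsLoopSolution (L : ℝ) (x y z b : ℝ → ℝ) : Prop where
  deriv_x : ∀ t : ℝ, HasDerivAt x (-(x t * z t)) t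
  deriv_y : ∀ t : ℝ, HasDerivAt y (y t * z t) t
  deriv_z : ∀ t : ℝ, HasDerivAt z (x t ^ 2 - y t ^ 2) t
  deriv_b : ∀ t : ℝ, HasDerivAt b (y t - b t * z t) t
  y_lt_x : y 0 < x 0
  y_pos : 0 < y 0
  z_zero : z 0 = 0
  b_zero : b 0 = 0
  mem_level : ∃ Θ : Set (ℝ × ℝ × ℝ), IsLoopLevelSet Θ ∧ HasPeriod Θ L ∧ (x 0, y 0, z 0) ∈ Θ

open Classical in
/-- The function `b̲_L`: the `b`-component of the solution attached to the loop level set of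
period `L`. (Such a level set exists, and is then unique, exactly for `L > π√2`, and
the solution is unique; for other `L` the value `0` is a placeholder.) -/
noncomputable def bBar (L : ℝ) : ℝ → ℝ :=
  if h : ∃ b : ℝ → ℝ, ∃ x y z : ℝ → ℝ, IsLoopSolution L x y z b then h.choose else fun _ => 0

end SolFlow

/-!
Along the loop of level `c = xy`, the solution with `b(0) = 0` is `b = J / y`, where `J = ∫₀ᵗ y²`.
The loop is parametrized by an angle `φ`: with `p = x + y` and `q = x - y` one has
`q = √(1 - 2c) cos φ`, `z = √(1 - 2c) sin φ`, and `φ' = p = √(1 + 2c - (1 - 2c) sin² φ)`. So time,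
and in particular the period `L(c)`, is an explicit integral in `φ`, which is differentiable and
strictly decreasing in `c` (`hasDerivAt_loopPeriod`, `strictAntiOn_loopPeriod`) and unbounded as
`c → 0`. Thus `bBar L` is `J / y` at the level `c(L)`, and `c(L)` is differentiable with negative
derivative.

The triple `(y, z, J)` solves a quadratic system that does not involve `c`. Its linearization along
an orbit can be solved in closed form, which gives the derivative of the orbit in `c`
(`hasDerivAt_reducedOrbit_level`) and
`∂(J / y)/∂c = -H / (c (1 - 4c²) y)`, with
`H = z (J² - 2c²t J - y²) + (1 - 2y²) (J - c²t)` (`signFn`).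
So the derivative of `b` in `L` has the sign of `H`, and what remains is the sign of `H` for
`L/2 ≤ t ≤ L` and small `c`. There `c²t` is negligible, `z ≤ 0`, and `K = J + z = ∫₀ᵗ x²` is nearly
at least `1`.

* Since `H ≈ z (K² - x²) - (1 - 2x²) K`, it is negative while `x ≤ 1/3` (`signFn_neg_of_x_le`).
* Where `x ≥ 1/3`, the orbit is near its end, `y` is negligible and `J ≈ 2`. There `H` increases in
  time (`strictMonoOn_signFn`), is negative at `L - 1` and positive at `L`. This gives the unique
  sign change `t_L` in `(L - 1, L)` (`exists_sign_change`).
* For `L - 1 ≤ t ≤ L` the closed formulas also show that `H` at fixed `t` increases with `c`, hence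
  decreases with `L`, the dominant term being `J³ (x² - y²)`. Hence `H < 0` at time `t_L` on the loop
  of a slightly longer period, and `t_L` increases (`signFn_levelOfPeriod_lt`).
-/

namespace SolFlow

open Real Set Filter Topology

variable {c : ℝ}

/-! ### The amplitude -/

/-- The square of the angular speed: on the loop of level `c`, the point at angle `θ` moves with
angular speed `√(radicand c θ)`. -/
noncomputable def radicand (c θ : ℝ) : ℝ := 1 + 2 * c - (1 - 2 * c) * sin θ ^ 2

/-- The time needed to move from angle `0` to angle `φ` on the loop of level `c`. -/
noncomputable def travelTime (c φ : ℝ) : ℝ := ∫ θ in (0 : ℝ)..φ, (√(radicand c θ))⁻¹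

/-- The period of the loop of level `c`. -/
noncomputable def loopPeriod (c : ℝ) : ℝ := travelTime c (2 * π)

/-- The angle reached at time `t` on the loop of level `c`, for `0 < c < 1/2`: the inverse function of
`travelTime c`. Angle `0` is the point with `z = 0` and `x > y`. -/
noncomputable def amplitude (c : ℝ) : ℝ → ℝ := Function.invFun (travelTime c)

theorem radicand_ge (hc : c ∈ Ioo (0 : ℝ) (1 / 2)) (θ : ℝ) : 4 * c ≤ radicand c θ := by
  have h1 := hc.2
  have h2 := sin_sq_le_one θ
  unfold radicand
  nlinarith

theorem radicand_pos (hc : c ∈ Ioo (0 : ℝ) (1 / 2)) (θ : ℝ) : 0 < radicand c θ := by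
  have h1 := hc.1
  have h2 := radicand_ge hc θ
  linarith

theorem radicand_le (hc : c ∈ Ioo (0 : ℝ) (1 / 2)) (θ : ℝ) : radicand c θ ≤ 2 ^ 2 := by
  have h1 := hc.2
  have h2 := mul_nonneg (by linarith : (0 : ℝ) ≤ 1 - 2 * c) (sq_nonneg (sin θ))
  unfold radicand
  linarith

theorem continuous_radicand (c : ℝ) : Continuous (radicand c) := by
  unfold radicand
  fun_prop

theorem continuous_inv_sqrt_radicand (hc : c ∈ Ioo (0 : ℝ) (1 / 2)) :
    Continuous fun θ => (√(radicand c θ))⁻¹ :=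
  (continuous_radicand c).sqrt.inv₀ fun θ => (sqrt_pos.2 (radicand_pos hc θ)).ne'

theorem hasDerivAt_travelTime (hc : c ∈ Ioo (0 : ℝ) (1 / 2)) (φ : ℝ) :
    HasDerivAt (travelTime c) (√(radicand c φ))⁻¹ φ :=
  (continuous_inv_sqrt_radicand hc).integral_hasStrictDerivAt 0 φ |>.hasDerivAt

theorem travelTime_zero (c : ℝ) : travelTime c 0 = 0 := by
  simp [travelTime]

theorem strictMono_travelTime (hc : c ∈ Ioo (0 : ℝ) (1 / 2)) : StrictMono (travelTime c) :=
  strictMono_of_hasDerivAt_pos (hasDerivAt_travelTime hc)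
    fun φ => inv_pos.2 (sqrt_pos.2 (radicand_pos hc φ))

theorem travelTime_add_pi (hc : c ∈ Ioo (0 : ℝ) (1 / 2)) (φ : ℝ) :
    travelTime c (φ + π) = travelTime c φ + travelTime c π := by
  have hper : Function.Periodic (fun θ => (√(radicand c θ))⁻¹) π := fun θ => by
    simp [radicand, sin_add_pi]
  have hint : ∀ a b, IntervalIntegrable (fun θ => (√(radicand c θ))⁻¹) MeasureTheory.volume a b :=
    fun a b => (continuous_inv_sqrt_radicand hc).intervalIntegrable a b
  have h := hper.intervalIntegral_add_eq φ 0
  rw [zero_add] at h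
  unfold travelTime
  rw [← h, intervalIntegral.integral_add_adjacent_intervals (hint _ _) (hint _ _)]

theorem travelTime_pi (hc : c ∈ Ioo (0 : ℝ) (1 / 2)) : travelTime c π = loopPeriod c / 2 := by
  have h := travelTime_add_pi hc π
  rw [← two_mul] at h
  rw [loopPeriod, h]
  ring

theorem surjective_travelTime (hc : c ∈ Ioo (0 : ℝ) (1 / 2)) :
    Function.Surjective (travelTime c) := by
  have hmono : Monotone fun φ => travelTime c φ - φ / 2 := by
    refine monotone_of_hasDerivAt_nonneg
      (fun φ => (hasDerivAt_travelTime hc φ).sub ((hasDerivAt_id φ).div_const 2)) fun φ => ?_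
    have h1 : √(radicand c φ) ≤ 2 := sqrt_le_iff.2 ⟨by norm_num, radicand_le hc φ⟩
    have h2 : (2 : ℝ)⁻¹ ≤ (√(radicand c φ))⁻¹ :=
      inv_anti₀ (sqrt_pos.2 (radicand_pos hc φ)) h1
    simp only [Pi.zero_apply]
    linarith
  have h0 := travelTime_zero c
  refine Continuous.surjective
    (continuous_iff_continuousAt.2 fun φ => (hasDerivAt_travelTime hc φ).continuousAt) ?_ ?_
  · refine tendsto_atTop_mono' _ ?_ (tendsto_id.atTop_div_const (by norm_num : (0 : ℝ) < 2))
    filter_upwards [eventually_ge_atTop 0] with φ hφ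
    have := hmono hφ
    simp only [h0, id] at this ⊢
    linarith
  · refine tendsto_atBot_mono' _ ?_ (tendsto_id.atBot_div_const (by norm_num : (0 : ℝ) < 2))
    filter_upwards [eventually_le_atBot 0] with φ hφ
    have := hmono hφ
    simp only [h0, id] at this ⊢
    linarith

theorem amplitude_travelTime (hc : c ∈ Ioo (0 : ℝ) (1 / 2)) (φ : ℝ) :
    amplitude c (travelTime c φ) = φ :=
  Function.leftInverse_invFun (strictMono_travelTime hc).injective φ

theorem travelTime_amplitude (hc : c ∈ Ioo (0 : ℝ) (1 / 2)) (t : ℝ) :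
    travelTime c (amplitude c t) = t :=
  Function.rightInverse_invFun (surjective_travelTime hc) t

theorem strictMono_amplitude (hc : c ∈ Ioo (0 : ℝ) (1 / 2)) : StrictMono (amplitude c) := by
  intro s t hst
  rw [← (strictMono_travelTime hc).lt_iff_lt, travelTime_amplitude hc, travelTime_amplitude hc]
  exact hst

theorem amplitude_zero (hc : c ∈ Ioo (0 : ℝ) (1 / 2)) : amplitude c 0 = 0 := by
  simpa [travelTime_zero] using amplitude_travelTime hc 0

theorem hasDerivAt_amplitude (hc : c ∈ Ioo (0 : ℝ) (1 / 2)) (t : ℝ) :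
    HasDerivAt (amplitude c) (√(radicand c (amplitude c t))) t := by
  have hcont : Continuous (amplitude c) :=
    (strictMono_amplitude hc).monotone.continuous_of_surjective
      fun φ => ⟨_, amplitude_travelTime hc φ⟩
  have h := HasDerivAt.of_local_left_inverse hcont.continuousAt
    (hasDerivAt_travelTime hc (amplitude c t))
    (inv_pos.2 (sqrt_pos.2 (radicand_pos hc _))).ne'
    (Eventually.of_forall (travelTime_amplitude hc))
  rwa [inv_inv] at h

theorem loopPeriod_pos (hc : c ∈ Ioo (0 : ℝ) (1 / 2)) : 0 < loopPeriod c := by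
  have := strictMono_travelTime hc two_pi_pos
  rwa [travelTime_zero] at this

/-! ### The orbits -/

/-- A solution of the backward flow of the structure field. -/
structure IsBackwardOrbit (x y z : ℝ → ℝ) : Prop where
  deriv_x : ∀ t : ℝ, HasDerivAt x (-(x t * z t)) t
  deriv_y : ∀ t : ℝ, HasDerivAt y (y t * z t) t
  deriv_z : ∀ t : ℝ, HasDerivAt z (x t ^ 2 - y t ^ 2) t

theorem IsBackwardOrbit.mul_eq {x y z : ℝ → ℝ} (h : IsBackwardOrbit x y z) (s t : ℝ) :
    x s * y s = x t * y t := by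
  refine is_const_of_deriv_eq_zero (f := fun t => x t * y t)
    (fun t => ((h.deriv_x t).mul (h.deriv_y t)).differentiableAt) (fun t => ?_) s t
  rw [((h.deriv_x t).fun_mul (h.deriv_y t)).deriv]
  ring

theorem IsBackwardOrbit.sq_add_eq {x y z : ℝ → ℝ} (h : IsBackwardOrbit x y z) (s t : ℝ) :
    x s ^ 2 + y s ^ 2 + z s ^ 2 = x t ^ 2 + y t ^ 2 + z t ^ 2 := by
  have hd : ∀ t, HasDerivAt (fun t => x t ^ 2 + y t ^ 2 + z t ^ 2) 0 t := fun t => by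
    convert! (((h.deriv_x t).fun_pow 2).fun_add ((h.deriv_y t).fun_pow 2)).fun_add
      ((h.deriv_z t).fun_pow 2) using 1
    push_cast
    ring
  exact is_const_of_deriv_eq_zero (fun t => (hd t).differentiableAt) (fun t => (hd t).deriv) s t

/-- The `z`-coordinate of the orbit of level `c` issuing from angle `0`. -/
noncomputable def orbitZ (c t : ℝ) : ℝ := √(1 - 2 * c) * sin (amplitude c t)

/-- The `x`-coordinate of the orbit of level `c` issuing from angle `0`. -/
noncomputable def orbitX (c t : ℝ) : ℝ :=
  (√(radicand c (amplitude c t)) + √(1 - 2 * c) * cos (amplitude c t)) / 2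

/-- The `y`-coordinate of the orbit of level `c` issuing from angle `0`. -/
noncomputable def orbitY (c t : ℝ) : ℝ :=
  (√(radicand c (amplitude c t)) - √(1 - 2 * c) * cos (amplitude c t)) / 2

theorem orbitX_mul_orbitY (hc : c ∈ Ioo (0 : ℝ) (1 / 2)) (t : ℝ) : orbitX c t * orbitY c t = c := by
  have h1 := sq_sqrt (radicand_pos hc (amplitude c t)).le
  have h2 := sq_sqrt (by linarith [hc.2] : (0 : ℝ) ≤ 1 - 2 * c)
  have h3 := sin_sq_add_cos_sq (amplitude c t)
  have h4 : radicand c (amplitude c t) = 1 + 2 * c - (1 - 2 * c) * sin (amplitude c t) ^ 2 := rfl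
  unfold orbitX orbitY
  linear_combination h1 / 4 - cos (amplitude c t) ^ 2 * h2 / 4 + h4 / 4 - (1 - 2 * c) / 4 * h3

theorem orbit_sphere (hc : c ∈ Ioo (0 : ℝ) (1 / 2)) (t : ℝ) :
    orbitX c t ^ 2 + orbitY c t ^ 2 + orbitZ c t ^ 2 = 1 := by
  have h1 := sq_sqrt (radicand_pos hc (amplitude c t)).le
  have h2 := sq_sqrt (by linarith [hc.2] : (0 : ℝ) ≤ 1 - 2 * c)
  have h3 := sin_sq_add_cos_sq (amplitude c t)
  have h4 : radicand c (amplitude c t) = 1 + 2 * c - (1 - 2 * c) * sin (amplitude c t) ^ 2 := rfl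
  unfold orbitX orbitY orbitZ
  linear_combination h1 / 2 + (cos (amplitude c t) ^ 2 / 2 + sin (amplitude c t) ^ 2) * h2
    + h4 / 2 + (1 - 2 * c) / 2 * h3

theorem orbitX_pos (hc : c ∈ Ioo (0 : ℝ) (1 / 2)) (t : ℝ) : 0 < orbitX c t := by
  have h1 := orbitX_mul_orbitY hc t
  have h2 := sqrt_pos.2 (radicand_pos hc (amplitude c t))
  have h3 : 0 < orbitX c t + orbitY c t := by unfold orbitX orbitY; linarith
  by_contra! h
  have h4 : 0 ≤ orbitY c t := by linarith
  have := hc.1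
  nlinarith

theorem orbitY_pos (hc : c ∈ Ioo (0 : ℝ) (1 / 2)) (t : ℝ) : 0 < orbitY c t := by
  have h1 := orbitX_mul_orbitY hc t
  exact pos_of_mul_pos_right (by rw [h1]; exact hc.1) (orbitX_pos hc t).le

theorem isBackwardOrbit_orbit (hc : c ∈ Ioo (0 : ℝ) (1 / 2)) :
    IsBackwardOrbit (orbitX c) (orbitY c) (orbitZ c) := by
  have hA := fun t => hasDerivAt_amplitude hc t
  have hq : ∀ t, HasDerivAt (fun t => √(1 - 2 * c) * cos (amplitude c t))
      (-(√(radicand c (amplitude c t)) * orbitZ c t)) t := fun t => by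
    convert! ((hA t).cos).const_mul (√(1 - 2 * c)) using 1
    unfold orbitZ
    ring
  have hp : ∀ t, HasDerivAt (fun t => √(radicand c (amplitude c t)))
      (-(√(1 - 2 * c) * cos (amplitude c t) * orbitZ c t)) t := fun t => by
    have hr : HasDerivAt (fun t => radicand c (amplitude c t))
        (-(2 * √(radicand c (amplitude c t)) * (√(1 - 2 * c) * cos (amplitude c t) * orbitZ c t)))
        t := by
      convert! (((hA t).sin.fun_pow 2).const_mul (1 - 2 * c)).const_sub (1 + 2 * c) using 1
      have h2 := sq_sqrt (by linarith [hc.2] : (0 : ℝ) ≤ 1 - 2 * c)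
      unfold orbitZ
      push_cast
      linear_combination (-2 * √(radicand c (amplitude c t)) * cos (amplitude c t)
        * sin (amplitude c t)) * h2
    convert! hr.sqrt (radicand_pos hc _).ne' using 1
    have := (sqrt_pos.2 (radicand_pos hc (amplitude c t))).ne'
    field_simp
  refine ⟨fun t => ?_, fun t => ?_, fun t => ?_⟩
  · convert! ((hp t).fun_add (hq t)).div_const 2 using 1
    unfold orbitX
    ring
  · convert! ((hp t).fun_sub (hq t)).div_const 2 using 1
    unfold orbitY
    ring
  · convert! (hA t).sin.const_mul (√(1 - 2 * c)) using 1
    unfold orbitX orbitY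
    ring

/-! ### Periodicity and uniqueness -/

theorem amplitude_add_period (hc : c ∈ Ioo (0 : ℝ) (1 / 2)) (t : ℝ) :
    amplitude c (t + loopPeriod c) = amplitude c t + 2 * π := by
  have h1 := travelTime_add_pi hc (amplitude c t)
  have h2 := travelTime_add_pi hc (amplitude c t + π)
  have h3 := travelTime_pi hc
  rw [h1, travelTime_amplitude hc, add_assoc, ← two_mul π] at h2
  rw [← amplitude_travelTime hc (amplitude c t + 2 * π), h2, h3]
  congr 1
  ring

theorem radicand_add_two_pi (c θ : ℝ) : radicand c (θ + 2 * π) = radicand c θ := by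
  simp [radicand]

theorem orbitX_add_period (hc : c ∈ Ioo (0 : ℝ) (1 / 2)) (t : ℝ) :
    orbitX c (t + loopPeriod c) = orbitX c t := by
  simp [orbitX, amplitude_add_period hc, radicand_add_two_pi]

theorem orbitY_add_period (hc : c ∈ Ioo (0 : ℝ) (1 / 2)) (t : ℝ) :
    orbitY c (t + loopPeriod c) = orbitY c t := by
  simp [orbitY, amplitude_add_period hc, radicand_add_two_pi]

theorem orbitZ_add_period (hc : c ∈ Ioo (0 : ℝ) (1 / 2)) (t : ℝ) :
    orbitZ c (t + loopPeriod c) = orbitZ c t := by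
  simp [orbitZ, amplitude_add_period hc]

theorem loopPeriod_le_of_orbit_eq (hc : c ∈ Ioo (0 : ℝ) (1 / 2)) {s t : ℝ} (hst : s < t)
    (hx : orbitX c s = orbitX c t) (hy : orbitY c s = orbitY c t) (hz : orbitZ c s = orbitZ c t) :
    loopPeriod c ≤ t - s := by
  by_contra! hlt
  have hα : √(1 - 2 * c) ≠ 0 := (sqrt_pos.2 (by linarith [hc.2])).ne'
  have hsin : sin (amplitude c s) = sin (amplitude c t) := mul_left_cancel₀ hα hz
  have hcos : cos (amplitude c s) = cos (amplitude c t) := by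
    refine mul_left_cancel₀ hα ?_
    unfold orbitX at hx
    unfold orbitY at hy
    linarith
  have hang := Real.Angle.cos_sin_inj hcos.symm hsin.symm
  obtain ⟨k, hk⟩ := Real.Angle.angle_eq_iff_two_pi_dvd_sub.1 hang
  have h1 := strictMono_amplitude hc hst
  have h2 := strictMono_amplitude hc (by linarith : t < s + loopPeriod c)
  rw [amplitude_add_period hc] at h2
  have hk0 : (0 : ℝ) < k := by
    refine pos_of_mul_pos_right (a := 2 * π) ?_ two_pi_pos.le
    linarith
  have hk1 : (k : ℝ) < 1 := by
    have := two_pi_pos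
    by_contra! h
    nlinarith
  have hk0' : 0 < k := by exact_mod_cast hk0
  have hk1' : k < 1 := by exact_mod_cast hk1
  omega

theorem exists_orbit_eq (hc : c ∈ Ioo (0 : ℝ) (1 / 2)) {x y z : ℝ} (hx : 0 < x) (hy : 0 < y)
    (hsph : x ^ 2 + y ^ 2 + z ^ 2 = 1) (hxy : x * y = c) :
    ∃ t, orbitX c t = x ∧ orbitY c t = y ∧ orbitZ c t = z := by
  set w : ℂ := ⟨x - y, z⟩ with hw
  have hnorm : ‖w‖ = √(1 - 2 * c) := by
    rw [Complex.norm_def, Complex.normSq_apply]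
    congr 1
    simp only [hw]
    linear_combination hsph - 2 * hxy
  have h1 := Complex.norm_mul_cos_arg w
  have h2 := Complex.norm_mul_sin_arg w
  rw [hnorm] at h1 h2
  simp only [hw] at h1 h2
  rw [← hw] at h1 h2
  have hrad : √(radicand c w.arg) = x + y := by
    rw [sqrt_eq_iff_mul_self_eq_of_pos (by linarith)]
    have h3 := sq_sqrt (by linarith [hc.2] : (0 : ℝ) ≤ 1 - 2 * c)
    unfold radicand
    linear_combination hsph + 2 * hxy - sin w.arg ^ 2 * h3
      + (√(1 - 2 * c) * sin w.arg + z) * h2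
  refine ⟨travelTime c w.arg, ?_, ?_, ?_⟩
  · rw [orbitX, amplitude_travelTime hc, hrad, h1]; ring
  · rw [orbitY, amplitude_travelTime hc, hrad, h1]; ring
  · rw [orbitZ, amplitude_travelTime hc, h2]

/-- The field `(yz, 1 - z² - 2y², y²)` obeyed by `(y, z, ∫ y²)` along an orbit on the unit sphere.
It does not involve the level. -/
def reducedField (p : ℝ × ℝ × ℝ) : ℝ × ℝ × ℝ :=
  (p.1 * p.2.1, 1 - p.2.1 ^ 2 - 2 * p.1 ^ 2, p.1 ^ 2)

/-- The region `|y| ≤ 1`, `|z| ≤ 1`, on which the reduced field is Lipschitz. -/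
def reducedBox : Set (ℝ × ℝ × ℝ) := {p | |p.1| ≤ 1 ∧ |p.2.1| ≤ 1}

theorem lipschitzOnWith_reducedField : LipschitzOnWith 6 reducedField reducedBox := by
  refine LipschitzOnWith.of_dist_le_mul fun p hp q hq => ?_
  obtain ⟨y, z, j⟩ := p
  obtain ⟨y', z', j'⟩ := q
  obtain ⟨h1, h2⟩ := hp
  obtain ⟨h3, h4⟩ := hq
  simp only at h1 h2 h3 h4
  simp only [Prod.dist_eq, reducedField, Real.dist_eq, NNReal.coe_ofNat]
  set d := max |y - y'| (max |z - z'| |j - j'|) with hd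
  have hy : |y - y'| ≤ d := le_max_left _ _
  have hz : |z - z'| ≤ d := (le_max_left _ _).trans (le_max_right _ _)
  have hd0 : 0 ≤ d := (abs_nonneg _).trans hy
  have hyy : |y ^ 2 - y' ^ 2| ≤ 2 * d := by
    rw [show y ^ 2 - y' ^ 2 = (y + y') * (y - y') by ring, abs_mul]
    exact mul_le_mul ((abs_add_le _ _).trans (by linarith)) hy (abs_nonneg _) (by norm_num)
  have hzz : |z ^ 2 - z' ^ 2| ≤ 2 * d := by
    rw [show z ^ 2 - z' ^ 2 = (z + z') * (z - z') by ring, abs_mul]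
    exact mul_le_mul ((abs_add_le _ _).trans (by linarith)) hz (abs_nonneg _) (by norm_num)
  have hyz : |y * z - y' * z'| ≤ 2 * d := by
    rw [show y * z - y' * z' = y * (z - z') + z' * (y - y') by ring]
    refine (abs_add_le _ _).trans ?_
    rw [abs_mul, abs_mul]
    have e1 := mul_le_mul h1 hz (abs_nonneg _) (by norm_num)
    have e2 := mul_le_mul h4 hy (abs_nonneg _) (by norm_num)
    linarith
  refine max_le (by linarith) (max_le ?_ (by linarith))
  rw [show 1 - z ^ 2 - 2 * y ^ 2 - (1 - z' ^ 2 - 2 * y' ^ 2)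
    = -(z ^ 2 - z' ^ 2) - 2 * (y ^ 2 - y' ^ 2) by ring]
  refine (abs_sub _ _).trans ?_
  rw [abs_neg, abs_mul, abs_two]
  linarith

/-- Two solutions of the reduced system separate at most exponentially, at a rate that does not
depend on them. -/
theorem dist_reduced_le {f g : ℝ → ℝ × ℝ × ℝ} (hf : ∀ t, HasDerivAt f (reducedField (f t)) t)
    (hg : ∀ t, HasDerivAt g (reducedField (g t)) t) (hfb : ∀ t, f t ∈ reducedBox)
    (hgb : ∀ t, g t ∈ reducedBox) {t : ℝ} (ht : 0 ≤ t) :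
    dist (f t) (g t) ≤ dist (f 0) (g 0) * exp (6 * t) := by
  have h := dist_le_of_trajectories_ODE_of_mem (a := 0) (b := t) (K := 6)
    (v := fun _ => reducedField) (s := fun _ => reducedBox) (f := f) (g := g)
    (fun _ _ => lipschitzOnWith_reducedField)
    (fun s _ => (hf s).continuousAt.continuousWithinAt) (fun s _ => (hf s).hasDerivWithinAt)
    (fun s _ => hfb s)
    (fun s _ => (hg s).continuousAt.continuousWithinAt) (fun s _ => (hg s).hasDerivWithinAt)
    (fun s _ => hgb s) le_rfl t ⟨ht, le_rfl⟩
  simpa using h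

theorem IsBackwardOrbit.hasDerivAt_reduced {x y z j : ℝ → ℝ} (h : IsBackwardOrbit x y z)
    (hsph : x 0 ^ 2 + y 0 ^ 2 + z 0 ^ 2 = 1) (hj : ∀ t, HasDerivAt j (y t ^ 2) t) (t : ℝ) :
    HasDerivAt (fun t => (y t, z t, j t)) (reducedField (y t, z t, j t)) t := by
  convert! (h.deriv_y t).prodMk ((h.deriv_z t).prodMk (hj t)) using 1
  have := h.sq_add_eq t 0
  simp only [reducedField, Prod.mk.injEq, true_and, and_true]
  linarith

theorem IsBackwardOrbit.mem_reducedBox {x y z : ℝ → ℝ} (h : IsBackwardOrbit x y z)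
    (hsph : x 0 ^ 2 + y 0 ^ 2 + z 0 ^ 2 = 1) (j : ℝ → ℝ) (t : ℝ) :
    (y t, z t, j t) ∈ reducedBox := by
  have := h.sq_add_eq t 0
  exact ⟨(sq_le_one_iff_abs_le_one _).1 (by nlinarith [sq_nonneg (x t), sq_nonneg (z t)]),
    (sq_le_one_iff_abs_le_one _).1 (by nlinarith [sq_nonneg (x t), sq_nonneg (y t)])⟩

/-- The integral of `y²` along the orbit of level `c`, from time `0`. -/
noncomputable def orbitJ (c t : ℝ) : ℝ := ∫ s in (0 : ℝ)..t, orbitY c s ^ 2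

theorem hasDerivAt_orbitJ (hc : c ∈ Ioo (0 : ℝ) (1 / 2)) (t : ℝ) :
    HasDerivAt (orbitJ c) (orbitY c t ^ 2) t := by
  have hcont : Continuous fun s => orbitY c s ^ 2 :=
    (continuous_iff_continuousAt.2 fun s =>
      ((isBackwardOrbit_orbit hc).deriv_y s).continuousAt).pow 2
  exact (hcont.integral_hasStrictDerivAt 0 t).hasDerivAt

theorem orbitJ_zero (c : ℝ) : orbitJ c 0 = 0 := by simp [orbitJ]

/-- The orbit of level `c` in the coordinates `(y, z, ∫ y²)`. -/
noncomputable def reducedOrbit (c t : ℝ) : ℝ × ℝ × ℝ := (orbitY c t, orbitZ c t, orbitJ c t)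

theorem hasDerivAt_reducedOrbit (hc : c ∈ Ioo (0 : ℝ) (1 / 2)) (t : ℝ) :
    HasDerivAt (reducedOrbit c) (reducedField (reducedOrbit c t)) t :=
  (isBackwardOrbit_orbit hc).hasDerivAt_reduced (orbit_sphere hc 0) (hasDerivAt_orbitJ hc) t

theorem reducedOrbit_mem_reducedBox (hc : c ∈ Ioo (0 : ℝ) (1 / 2)) (t : ℝ) :
    reducedOrbit c t ∈ reducedBox :=
  (isBackwardOrbit_orbit hc).mem_reducedBox (orbit_sphere hc 0) _ t

/-- Forward uniqueness: an orbit that starts where the orbit of level `c` does follows it, together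
with any primitive of `y²` vanishing at `0`. -/
theorem IsBackwardOrbit.eq_orbit (hc : c ∈ Ioo (0 : ℝ) (1 / 2)) {x y z j : ℝ → ℝ}
    (h : IsBackwardOrbit x y z) (hx0 : x 0 = orbitX c 0) (hy0 : y 0 = orbitY c 0)
    (hz0 : z 0 = orbitZ c 0) (hj : ∀ t, HasDerivAt j (y t ^ 2) t) (hj0 : j 0 = 0) {t : ℝ}
    (ht : 0 ≤ t) :
    x t = orbitX c t ∧ y t = orbitY c t ∧ z t = orbitZ c t ∧ j t = orbitJ c t := by
  have hsph : x 0 ^ 2 + y 0 ^ 2 + z 0 ^ 2 = 1 := by rw [hx0, hy0, hz0, orbit_sphere hc]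
  have hd := dist_reduced_le (h.hasDerivAt_reduced hsph hj) (hasDerivAt_reducedOrbit hc)
    (h.mem_reducedBox hsph j) (reducedOrbit_mem_reducedBox hc) ht
  have h0 : (y 0, z 0, j 0) = reducedOrbit c 0 := by
    rw [reducedOrbit, hy0, hz0, hj0, orbitJ_zero]
  rw [h0, dist_self, zero_mul] at hd
  have heq := dist_le_zero.1 hd
  simp only [reducedOrbit, Prod.mk.injEq] at heq
  refine ⟨?_, heq⟩
  have h1 := h.mul_eq t 0
  rw [hx0, hy0, orbitX_mul_orbitY hc, ← orbitX_mul_orbitY hc t, heq.1] at h1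
  exact mul_right_cancel₀ (orbitY_pos hc t).ne' h1

theorem orbitZ_zero (hc : c ∈ Ioo (0 : ℝ) (1 / 2)) : orbitZ c 0 = 0 := by
  simp [orbitZ, amplitude_zero hc]

theorem orbitX_zero (hc : c ∈ Ioo (0 : ℝ) (1 / 2)) :
    orbitX c 0 = (√(1 + 2 * c) + √(1 - 2 * c)) / 2 := by
  simp [orbitX, amplitude_zero hc, radicand]

theorem orbitY_zero (hc : c ∈ Ioo (0 : ℝ) (1 / 2)) :
    orbitY c 0 = (√(1 + 2 * c) - √(1 - 2 * c)) / 2 := by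
  simp [orbitY, amplitude_zero hc, radicand]

/-- The loop of level `c` in the positive sector. -/
def loopSet (c : ℝ) : Set (ℝ × ℝ × ℝ) :=
  {p | 0 < p.1 ∧ 0 < p.2.1 ∧ p.1 ^ 2 + p.2.1 ^ 2 + p.2.2 ^ 2 = 1 ∧ p.1 * p.2.1 = c}

theorem orbit_mem_loopSet (hc : c ∈ Ioo (0 : ℝ) (1 / 2)) (t : ℝ) :
    (orbitX c t, orbitY c t, orbitZ c t) ∈ loopSet c :=
  ⟨orbitX_pos hc t, orbitY_pos hc t, orbit_sphere hc t, orbitX_mul_orbitY hc t⟩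

theorem hasPeriod_loopSet (hc : c ∈ Ioo (0 : ℝ) (1 / 2)) :
    HasPeriod (loopSet c) (loopPeriod c) := by
  rintro ⟨x, y, z⟩ ⟨hx, hy, hsph, hxy⟩
  obtain ⟨t₀, hx₀, hy₀, hz₀⟩ := exists_orbit_eq hc hx hy hsph hxy
  simp only at hx₀ hy₀ hz₀
  have horb := isBackwardOrbit_orbit hc
  -- Flowlines run backwards along the orbits.
  refine ⟨fun t => (orbitX c (t₀ - t), orbitY c (t₀ - t), orbitZ c (t₀ - t)), fun t => ?_, ?_, ?_⟩
  · have hr : HasDerivAt (fun t => t₀ - t) (-1) t := (hasDerivAt_id t).const_sub t₀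
    convert! ((horb.deriv_x (t₀ - t)).comp t hr).prodMk
      (((horb.deriv_y (t₀ - t)).comp t hr).prodMk ((horb.deriv_z (t₀ - t)).comp t hr)) using 1
    simp only [structureField, Prod.mk.injEq]
    refine ⟨by ring, by ring, by ring⟩
  · simp [hx₀, hy₀, hz₀]
  · refine ⟨⟨loopPeriod_pos hc, ?_⟩, fun T hT => ?_⟩
    · have h1 := orbitX_add_period hc (t₀ - loopPeriod c)
      have h2 := orbitY_add_period hc (t₀ - loopPeriod c)
      have h3 := orbitZ_add_period hc (t₀ - loopPeriod c)
      simp only [sub_add_cancel] at h1 h2 h3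
      simp [h1, h2, h3]
    · obtain ⟨hT0, hT⟩ := hT
      simp only [sub_zero, Prod.mk.injEq] at hT
      have := loopPeriod_le_of_orbit_eq hc (by linarith : t₀ - T < t₀) hT.1 hT.2.1 hT.2.2
      linarith

theorem HasPeriod.eq_loopPeriod (hc : c ∈ Ioo (0 : ℝ) (1 / 2)) {L : ℝ}
    (h : HasPeriod (loopSet c) L) : L = loopPeriod c := by
  obtain ⟨γ, hγ, hγ0, hL⟩ := h _ (orbit_mem_loopSet hc 0)
  have horb : IsBackwardOrbit (fun t => (γ t).1) (fun t => (γ t).2.1) (fun t => -(γ t).2.2) := by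
    refine ⟨fun t => ?_, fun t => ?_, fun t => ?_⟩
    · convert! (hγ t).hasFDerivAt.fst.hasDerivAt using 1
      simp [structureField]
    · convert! (hγ t).hasFDerivAt.snd.fst.hasDerivAt using 1
      simp [structureField]
    · convert! (hγ t).hasFDerivAt.snd.snd.hasDerivAt.fun_neg using 1
      simp [structureField]
      ring
  have hcont : Continuous fun s => (γ s).2.1 ^ 2 :=
    (continuous_iff_continuousAt.2 fun s => (horb.deriv_y s).continuousAt).pow 2
  have heq : ∀ t, 0 ≤ t → (γ t).1 = orbitX c t ∧ (γ t).2.1 = orbitY c t ∧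
      (γ t).2.2 = -orbitZ c t := fun t ht => by
    obtain ⟨h1, h2, h3, -⟩ := horb.eq_orbit hc (by simp [hγ0]) (by simp [hγ0])
      (by simp [hγ0, orbitZ_zero hc])
      (fun t => (hcont.integral_hasStrictDerivAt 0 t).hasDerivAt) (by simp) ht
    exact ⟨h1, h2, by linarith⟩
  have hret : ∀ t, 0 ≤ t → (γ t = γ 0 ↔
      orbitX c t = orbitX c 0 ∧ orbitY c t = orbitY c 0 ∧ orbitZ c t = orbitZ c 0) :=
    fun t ht => by
      rw [Prod.ext_iff, Prod.ext_iff, (heq t ht).1, (heq t ht).2.1, (heq t ht).2.2,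
        (heq 0 le_rfl).1, (heq 0 le_rfl).2.1, (heq 0 le_rfl).2.2, neg_inj]
  refine le_antisymm (hL.2 ⟨loopPeriod_pos hc, (hret _ (loopPeriod_pos hc).le).2 ?_⟩) ?_
  · have h1 := orbitX_add_period hc 0
    have h2 := orbitY_add_period hc 0
    have h3 := orbitZ_add_period hc 0
    rw [zero_add] at h1 h2 h3
    exact ⟨h1, h2, h3⟩
  · obtain ⟨h0, hr⟩ := hL.1
    obtain ⟨h1, h2, h3⟩ := (hret L h0.le).1 hr
    simpa using loopPeriod_le_of_orbit_eq hc h0 h1.symm h2.symm h3.symm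

/-- The solutions attached to the loop of period `L` are those of the level `c` with that period,
and then `b = (∫ y²) / y`. -/
theorem IsLoopSolution.exists_level {L : ℝ} {x y z b : ℝ → ℝ} (h : IsLoopSolution L x y z b) :
    ∃ c ∈ Ioo (0 : ℝ) (1 / 2), loopPeriod c = L ∧
      ∀ t, 0 ≤ t → b t = orbitJ c t / orbitY c t := by
  obtain ⟨Θ, ⟨c, hc0, hc1, rfl⟩, hper, hx, hy, hsph, hxy⟩ := h.mem_level
  have hc : c ∈ Ioo (0 : ℝ) (1 / 2) := ⟨hc0, hc1⟩
  refine ⟨c, hc, (HasPeriod.eq_loopPeriod hc hper).symm, fun t ht => ?_⟩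
  simp only [h.z_zero] at hx hy hsph hxy
  have hadd : √(1 + 2 * c) = x 0 + y 0 := by
    rw [sqrt_eq_iff_mul_self_eq_of_pos (by linarith)]
    linear_combination hsph + 2 * hxy
  have hsub : √(1 - 2 * c) = x 0 - y 0 := by
    rw [sqrt_eq_iff_mul_self_eq_of_pos (by linarith [h.y_lt_x])]
    linear_combination hsph - 2 * hxy
  have horb : IsBackwardOrbit x y z := ⟨h.deriv_x, h.deriv_y, h.deriv_z⟩
  have hj : ∀ t, HasDerivAt (fun t => b t * y t) (y t ^ 2) t := fun t => by
    convert! (h.deriv_b t).fun_mul (h.deriv_y t) using 1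
    ring
  obtain ⟨-, h2, -, h4⟩ := horb.eq_orbit hc (by rw [orbitX_zero hc, hadd, hsub]; ring)
    (by rw [orbitY_zero hc, hadd, hsub]; ring) (by rw [orbitZ_zero hc, h.z_zero]) hj
    (by simp [h.b_zero]) ht
  rw [eq_div_iff (orbitY_pos hc t).ne', ← h4, h2]

theorem isLoopSolution_orbit (hc : c ∈ Ioo (0 : ℝ) (1 / 2)) :
    IsLoopSolution (loopPeriod c) (orbitX c) (orbitY c) (orbitZ c)
      (fun t => orbitJ c t / orbitY c t) := by
  have horb := isBackwardOrbit_orbit hc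
  refine ⟨horb.deriv_x, horb.deriv_y, horb.deriv_z, fun t => ?_, ?_, orbitY_pos hc 0,
    orbitZ_zero hc, by simp [orbitJ_zero], loopSet c, ⟨c, hc.1, hc.2, rfl⟩, hasPeriod_loopSet hc,
    orbit_mem_loopSet hc 0⟩
  · have hy := (orbitY_pos hc t).ne'
    convert! (hasDerivAt_orbitJ hc t).fun_div (horb.deriv_y t) hy using 1
    field_simp
  · rw [orbitX_zero hc, orbitY_zero hc]
    have := sqrt_pos.2 (by linarith [hc.2] : 0 < 1 - 2 * c)
    linarith

/-! ### The period as a function of the level -/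

theorem hasDerivAt_inv_sqrt_radicand (hc : c ∈ Ioo (0 : ℝ) (1 / 2)) (θ : ℝ) :
    HasDerivAt (fun c => (√(radicand c θ))⁻¹)
      (-((1 + sin θ ^ 2) / (radicand c θ * √(radicand c θ)))) c := by
  have hR := radicand_pos hc θ
  have hr : HasDerivAt (fun c => radicand c θ) (2 * (1 + sin θ ^ 2)) c := by
    have h2 : HasDerivAt (fun c : ℝ => 2 * c) 2 c := by
      simpa using (hasDerivAt_id c).const_mul (2 : ℝ)
    convert! (h2.const_add 1).fun_sub ((h2.const_sub 1).mul_const (sin θ ^ 2)) using 1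
    ring
  convert! (hr.sqrt hR.ne').fun_inv (sqrt_pos.2 hR).ne' using 1
  rw [sq_sqrt hR.le]
  have := (sqrt_pos.2 hR).ne'
  field_simp

/-- The derivative of the period with respect to the level. -/
noncomputable def loopPeriodDeriv (c : ℝ) : ℝ :=
  ∫ θ in (0 : ℝ)..2 * π, -((1 + sin θ ^ 2) / (radicand c θ * √(radicand c θ)))

theorem continuous_deriv_inv_sqrt_radicand (hc : c ∈ Ioo (0 : ℝ) (1 / 2)) :
    Continuous fun θ => (1 + sin θ ^ 2) / (radicand c θ * √(radicand c θ)) := by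
  have h := continuous_radicand c
  refine Continuous.div (by fun_prop) (h.mul h.sqrt) fun θ => ?_
  have hR := radicand_pos hc θ
  exact (mul_pos hR (sqrt_pos.2 hR)).ne'

theorem loopPeriodDeriv_neg (hc : c ∈ Ioo (0 : ℝ) (1 / 2)) : loopPeriodDeriv c < 0 := by
  rw [loopPeriodDeriv, intervalIntegral.integral_neg, neg_lt_zero]
  refine intervalIntegral.intervalIntegral_pos_of_pos
    ((continuous_deriv_inv_sqrt_radicand hc).intervalIntegrable _ _) (fun θ => ?_) two_pi_pos
  have hR := radicand_pos hc θ
  have := sqrt_pos.2 hR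
  positivity

theorem hasDerivAt_loopPeriod (hc : c ∈ Ioo (0 : ℝ) (1 / 2)) :
    HasDerivAt loopPeriod (loopPeriodDeriv c) c := by
  have hc0 := hc.1
  have hs : Ioo (c / 2) (1 / 2) ∈ 𝓝 c := Ioo_mem_nhds (by linarith) hc.2
  have hsub : ∀ c' ∈ Ioo (c / 2) (1 / 2), c' ∈ Ioo (0 : ℝ) (1 / 2) :=
    fun c' h => ⟨by linarith [h.1], h.2⟩
  refine (intervalIntegral.hasDerivAt_integral_of_dominated_loc_of_deriv_le
    (F := fun c θ => (√(radicand c θ))⁻¹)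
    (F' := fun c θ => -((1 + sin θ ^ 2) / (radicand c θ * √(radicand c θ))))
    (bound := fun _ => 2 / (2 * c * √(2 * c))) hs ?_ ?_ ?_ ?_ ?_ ?_).2
  · filter_upwards [hs] with c' hc'
    exact (continuous_inv_sqrt_radicand (hsub c' hc')).aestronglyMeasurable
  · exact (continuous_inv_sqrt_radicand hc).intervalIntegrable _ _
  · exact (continuous_deriv_inv_sqrt_radicand hc).neg.aestronglyMeasurable
  · refine Eventually.of_forall fun θ _ c' hc' => ?_
    have hR := radicand_pos (hsub c' hc') θ
    have hR' : 2 * c ≤ radicand c' θ := by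
      have h1 := radicand_ge (hsub c' hc') θ
      have h2 := hc'.1
      linarith
    have h3 := sin_sq_le_one θ
    have h4 := sqrt_pos.2 hR
    rw [norm_neg, norm_of_nonneg (by positivity)]
    have h5 : 0 < √(2 * c) := sqrt_pos.2 (by linarith)
    exact div_le_div₀ (by norm_num) (by linarith) (by positivity)
      (mul_le_mul hR' (sqrt_le_sqrt hR') (sqrt_nonneg _) hR.le)
  · exact intervalIntegrable_const
  · exact Eventually.of_forall fun θ _ c' hc' => hasDerivAt_inv_sqrt_radicand (hsub c' hc') θ

theorem continuousOn_loopPeriod : ContinuousOn loopPeriod (Ioo 0 (1 / 2)) :=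
  fun _ hc => (hasDerivAt_loopPeriod hc).continuousAt.continuousWithinAt

theorem strictAntiOn_loopPeriod : StrictAntiOn loopPeriod (Ioo 0 (1 / 2)) := by
  refine strictAntiOn_of_deriv_neg (convex_Ioo _ _) continuousOn_loopPeriod fun c hc => ?_
  rw [interior_Ioo] at hc
  rw [(hasDerivAt_loopPeriod hc).deriv]
  exact loopPeriodDeriv_neg hc

theorem loopPeriod_le (hc : c ∈ Ioo (0 : ℝ) (1 / 2)) : loopPeriod c ≤ π / √c := by
  have h0 := sqrt_pos.2 hc.1
  have h := intervalIntegral.norm_integral_le_of_norm_le_const (a := 0) (b := 2 * π)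
    (f := fun θ => (√(radicand c θ))⁻¹) (C := (2 * √c)⁻¹) fun θ _ => by
      have hle : 2 * √c ≤ √(radicand c θ) := by
        refine le_sqrt_of_sq_le ?_
        rw [mul_pow, sq_sqrt hc.1.le]
        linarith [radicand_ge hc θ]
      rw [norm_of_nonneg (by positivity)]
      exact inv_anti₀ (by positivity) hle
  refine (le_abs_self _).trans (h.trans (le_of_eq ?_))
  rw [sub_zero, abs_of_pos two_pi_pos]
  field_simp

/-- On the first quarter of the loop `y` grows from at most `√2 c` to `√c`, at an exponential rate
of at most `1`. Hence the period is unbounded as the level tends to `0`. -/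
theorem one_le_two_mul_exp_loopPeriod (hc : c ∈ Ioo (0 : ℝ) (1 / 2)) :
    1 ≤ 2 * c * exp (2 * loopPeriod c) := by
  set t := travelTime c (π / 2) with ht
  have htL : t ≤ loopPeriod c :=
    (strictMono_travelTime hc).monotone (by linarith [pi_pos] : π / 2 ≤ 2 * π)
  have ht0 : 0 ≤ t := by
    rw [← travelTime_zero c]
    exact (strictMono_travelTime hc).monotone (by linarith [pi_pos])
  have horb := isBackwardOrbit_orbit hc
  have hanti : Antitone fun s => orbitY c s * exp (-s) := by
    refine antitone_of_hasDerivAt_nonpos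
      (fun s => (horb.deriv_y s).fun_mul ((hasDerivAt_id s).fun_neg.exp)) fun s => ?_
    have h1 := orbitY_pos hc s
    have h2 := exp_pos (-s)
    have h3 : orbitZ c s ≤ 1 := by
      have := orbit_sphere hc s
      nlinarith [sq_nonneg (orbitX c s), sq_nonneg (orbitY c s)]
    have h4 : 0 ≤ orbitY c s * exp (-s) * (1 - orbitZ c s) :=
      mul_nonneg (by positivity) (by linarith)
    simp only [id, Pi.zero_apply]
    linarith
  have hyt : orbitY c t ^ 2 = c := by
    have h1 : orbitX c t = orbitY c t := by
      simp [orbitX, orbitY, ht, amplitude_travelTime hc]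
    rw [sq]
    nth_rewrite 1 [← h1]
    exact orbitX_mul_orbitY hc t
  have hy0 : orbitY c 0 ^ 2 ≤ 2 * c ^ 2 := by
    have h1 := orbit_sphere hc 0
    have h2 := orbitX_mul_orbitY hc 0
    have h3 : orbitY c 0 ≤ orbitX c 0 := by
      rw [orbitX_zero hc, orbitY_zero hc]
      linarith [sqrt_nonneg (1 - 2 * c)]
    have h4 := orbitY_pos hc 0
    rw [orbitZ_zero hc] at h1
    have h5 : 1 ≤ 2 * orbitX c 0 ^ 2 := by nlinarith
    have h6 : c ^ 2 = orbitX c 0 ^ 2 * orbitY c 0 ^ 2 := by rw [← mul_pow, h2]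
    nlinarith [sq_nonneg (orbitY c 0)]
  have hle : orbitY c t ≤ orbitY c 0 * exp t := by
    have := hanti ht0
    simp only [neg_zero, exp_zero, mul_one] at this
    calc orbitY c t = orbitY c t * exp (-t) * exp t := by
          rw [mul_assoc, ← exp_add]; simp
      _ ≤ _ := by gcongr
  have hc0 := hc.1
  have h6 : c ≤ 2 * c ^ 2 * exp (2 * loopPeriod c) := by
    calc c = orbitY c t ^ 2 := hyt.symm
      _ ≤ (orbitY c 0 * exp t) ^ 2 := by
          have := orbitY_pos hc t
          gcongr
      _ = orbitY c 0 ^ 2 * exp (2 * t) := by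
          rw [mul_pow, ← exp_nat_mul]; norm_num
      _ ≤ _ := by gcongr
  have h7 : c * 1 ≤ c * (2 * c * exp (2 * loopPeriod c)) := by linarith
  exact le_of_mul_le_mul_left h7 hc0

theorem exists_loopPeriod_eq (hc : c ∈ Ioo (0 : ℝ) (1 / 2)) {L : ℝ} (hL : loopPeriod c < L) :
    ∃ c' ∈ Ioo 0 c, loopPeriod c' = L := by
  obtain ⟨a, ha⟩ : ∃ a, a = min (c / 2) (exp (-(2 * L)) / 4) := ⟨_, rfl⟩
  have hc0 := hc.1
  have hexp := exp_pos (-(2 * L))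
  have ha0 : 0 < a := by rw [ha]; exact lt_min (by linarith) (by linarith)
  have hac : a < c := by rw [ha]; exact (min_le_left _ _).trans_lt (by linarith)
  have ha' : a ∈ Ioo (0 : ℝ) (1 / 2) := ⟨ha0, hac.trans hc.2⟩
  have hLa : L < loopPeriod a := by
    by_contra! h
    have h1 := one_le_two_mul_exp_loopPeriod ha'
    have h2 : exp (2 * loopPeriod a) ≤ exp (2 * L) := exp_le_exp.2 (by linarith)
    have h3 : a ≤ exp (-(2 * L)) / 4 := ha ▸ min_le_right _ _
    have h4 : exp (-(2 * L)) * exp (2 * L) = 1 := by rw [← exp_add]; simp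
    have h5 := exp_pos (2 * L)
    nlinarith
  obtain ⟨c', hc', h⟩ := intermediate_value_Ioo' hac.le
    (continuousOn_loopPeriod.mono fun x hx => ⟨ha0.trans_le hx.1, hx.2.trans_lt hc.2⟩) ⟨hL, hLa⟩
  exact ⟨c', ⟨ha0.trans hc'.1, hc'.2⟩, h⟩

/-- The level of the loop of period `L`, if there is one. -/
noncomputable def levelOfPeriod : ℝ → ℝ := Function.invFunOn loopPeriod (Ioo 0 (1 / 2))

theorem levelOfPeriod_loopPeriod (hc : c ∈ Ioo (0 : ℝ) (1 / 2)) :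
    levelOfPeriod (loopPeriod c) = c :=
  strictAntiOn_loopPeriod.injOn.leftInvOn_invFunOn hc

theorem levelOfPeriod_mem (hc : c ∈ Ioo (0 : ℝ) (1 / 2)) {L : ℝ} (hL : loopPeriod c < L) :
    levelOfPeriod L ∈ Ioo 0 c ∧ loopPeriod (levelOfPeriod L) = L := by
  obtain ⟨c', hc', rfl⟩ := exists_loopPeriod_eq hc hL
  rw [levelOfPeriod_loopPeriod ⟨hc'.1, hc'.2.trans hc.2⟩]
  exact ⟨hc', rfl⟩

theorem hasDerivAt_levelOfPeriod (hc : c ∈ Ioo (0 : ℝ) (1 / 2)) :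
    HasDerivAt levelOfPeriod (loopPeriodDeriv c)⁻¹ (loopPeriod c) := by
  -- Each interval around `c` is mapped by `loopPeriod` onto an interval around `loopPeriod c`.
  have key : ∀ a b, 0 < a → a < c → c < b → b < 1 / 2 →
      ∀ᶠ L in 𝓝 (loopPeriod c), levelOfPeriod L ∈ Ioo a b ∧ loopPeriod (levelOfPeriod L) = L := by
    intro a b ha hac hcb hb
    have hsub : Icc a b ⊆ Ioo 0 (1 / 2) := fun x hx => ⟨ha.trans_le hx.1, hx.2.trans_lt hb⟩
    have h1 := strictAntiOn_loopPeriod (hsub ⟨le_rfl, (hac.trans hcb).le⟩) hc hac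
    have h2 := strictAntiOn_loopPeriod hc (hsub ⟨(hac.trans hcb).le, le_rfl⟩) hcb
    filter_upwards [Ioo_mem_nhds h2 h1] with L hL
    obtain ⟨c', hc', rfl⟩ := intermediate_value_Ioo' (hac.trans hcb).le
      (continuousOn_loopPeriod.mono hsub) hL
    rw [levelOfPeriod_loopPeriod (hsub (Ioo_subset_Icc_self hc'))]
    exact ⟨hc', rfl⟩
  have hcont : ContinuousAt levelOfPeriod (loopPeriod c) := by
    rw [ContinuousAt, levelOfPeriod_loopPeriod hc, tendsto_order]
    constructor
    · intro a hac
      have h1 : max a (c / 2) < c := max_lt hac (by linarith [hc.1])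
      filter_upwards [key (max a (c / 2)) ((c + 1 / 2) / 2)
        (lt_max_of_lt_right (by linarith [hc.1])) h1 (by linarith [hc.2])
        (by linarith [hc.2])] with L hL
      exact (le_max_left _ _).trans_lt hL.1.1
    · intro b hcb
      have h1 : c < min b ((c + 1 / 2) / 2) := lt_min hcb (by linarith [hc.2])
      filter_upwards [key (c / 2) (min b ((c + 1 / 2) / 2)) (by linarith [hc.1])
        (by linarith [hc.1]) h1 (min_lt_of_right_lt (by linarith [hc.2]))] with L hL
      exact hL.1.2.trans_le (min_le_left _ _)
  refine HasDerivAt.of_local_left_inverse (f := loopPeriod) hcont ?_ (loopPeriodDeriv_neg hc).ne ?_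
  · rw [levelOfPeriod_loopPeriod hc]
    exact hasDerivAt_loopPeriod hc
  · filter_upwards [key (c / 2) ((c + 1 / 2) / 2) (by linarith [hc.1]) (by linarith [hc.1])
      (by linarith [hc.2]) (by linarith [hc.2])] with L hL
    exact hL.2

theorem bBar_loopPeriod (hc : c ∈ Ioo (0 : ℝ) (1 / 2)) {t : ℝ} (ht : 0 ≤ t) :
    bBar (loopPeriod c) t = orbitJ c t / orbitY c t := by
  have hex : ∃ b : ℝ → ℝ, ∃ x y z : ℝ → ℝ, IsLoopSolution (loopPeriod c) x y z b :=
    ⟨_, _, _, _, isLoopSolution_orbit hc⟩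
  rw [bBar, dif_pos hex]
  obtain ⟨x, y, z, h⟩ := hex.choose_spec
  obtain ⟨c', hc', hper, hb⟩ := h.exists_level
  rw [strictAntiOn_loopPeriod.injOn hc' hc hper] at hb
  exact hb t ht

/-! ### Variation of the level -/

/-- The linearization of `reducedField` at `p`, applied to `v`. -/
def reducedLinearization (p v : ℝ × ℝ × ℝ) : ℝ × ℝ × ℝ :=
  (v.1 * p.2.1 + p.1 * v.2.1, -(2 * p.2.1 * v.2.1) - 4 * p.1 * v.1, 2 * p.1 * v.1)

theorem norm_reducedLinearization_le {p : ℝ × ℝ × ℝ} (hp : p ∈ reducedBox) (v : ℝ × ℝ × ℝ) :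
    ‖reducedLinearization p v‖ ≤ 6 * ‖v‖ := by
  obtain ⟨h1, h2⟩ := hp
  have hy : |v.1| ≤ ‖v‖ := norm_fst_le v
  have hz : |v.2.1| ≤ ‖v‖ := (norm_fst_le v.2).trans (norm_snd_le v)
  have e1 : |v.1 * p.2.1| ≤ ‖v‖ := by
    rw [abs_mul]; nlinarith [abs_nonneg v.1]
  have e2 : |p.1 * v.2.1| ≤ ‖v‖ := by
    rw [abs_mul]; nlinarith [abs_nonneg v.2.1]
  have e3 : |p.2.1 * v.2.1| ≤ ‖v‖ := by
    rw [abs_mul]; nlinarith [abs_nonneg v.2.1]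
  have e4 : |p.1 * v.1| ≤ ‖v‖ := by
    rw [abs_mul]; nlinarith [abs_nonneg v.1]
  rw [abs_le] at e1 e2 e3 e4
  simp only [reducedLinearization, Prod.norm_def, Real.norm_eq_abs] at *
  refine max_le (abs_le.2 ⟨?_, ?_⟩) (max_le (abs_le.2 ⟨?_, ?_⟩) (abs_le.2 ⟨?_, ?_⟩)) <;> linarith

/-- The reduced field is quadratic, so it differs from its linearization by a quadratic term. -/
theorem norm_reducedField_sub_sub_le (p q : ℝ × ℝ × ℝ) :
    ‖reducedField q - reducedField p - reducedLinearization p (q - p)‖ ≤ 3 * ‖q - p‖ ^ 2 := by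
  have hy : |(q - p).1| ≤ ‖q - p‖ := norm_fst_le (q - p)
  have hz : |(q - p).2.1| ≤ ‖q - p‖ := (norm_fst_le (q - p).2).trans (norm_snd_le (q - p))
  have heq : reducedField q - reducedField p - reducedLinearization p (q - p) =
      ((q - p).1 * (q - p).2.1, -(q - p).2.1 ^ 2 - 2 * (q - p).1 ^ 2, (q - p).1 ^ 2) := by
    simp only [reducedField, reducedLinearization, Prod.ext_iff, Prod.fst_sub, Prod.snd_sub]
    refine ⟨by ring, by ring, by ring⟩
  rw [heq]
  generalize (q - p).1 = y at *
  generalize (q - p).2.1 = z at *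
  generalize ‖q - p‖ = d at *
  have hy2 : y ^ 2 ≤ d ^ 2 := sq_le_sq' (abs_le.1 hy).1 (abs_le.1 hy).2
  have hz2 : z ^ 2 ≤ d ^ 2 := sq_le_sq' (abs_le.1 hz).1 (abs_le.1 hz).2
  simp only [Prod.norm_def, Real.norm_eq_abs]
  have := sq_nonneg y
  have := sq_nonneg z
  refine max_le (abs_le.2 ⟨?_, ?_⟩) (max_le (abs_le.2 ⟨?_, ?_⟩) (abs_le.2 ⟨?_, ?_⟩)) <;>
    nlinarith [sq_nonneg (y + z), sq_nonneg (y - z)]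

/-- If `X c` solves the reduced system for each level `c`, and `V` solves its linearization along
`X c`, then `V t` is the derivative of `c ↦ X c t` as soon as this holds at `t = 0`. -/
theorem hasDerivAt_level_of_linearization {X : ℝ → ℝ → ℝ × ℝ × ℝ} {V : ℝ → ℝ × ℝ × ℝ}
    {U : Set ℝ} (hU : U ∈ 𝓝 c)
    (hX : ∀ c' ∈ U, ∀ t, HasDerivAt (X c') (reducedField (X c' t)) t)
    (hbox : ∀ c' ∈ U, ∀ t, X c' t ∈ reducedBox)
    (hV : ∀ t, HasDerivAt V (reducedLinearization (X c t) (V t)) t)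
    (h0 : HasDerivAt (fun c' => X c' 0) (V 0) c) {t : ℝ} (ht : 0 ≤ t) :
    HasDerivAt (fun c' => X c' t) (V t) c := by
  have hcU : c ∈ U := mem_of_mem_nhds hU
  set r : ℝ → ℝ → ℝ × ℝ × ℝ := fun c' s => X c' s - X c s - (c' - c) • V s with hr
  -- Grönwall's inequality for the remainder `r` of the first order expansion.
  have hbound : ∀ c' ∈ U, ‖r c' t‖ ≤
      ‖r c' 0‖ * exp (6 * t) + ‖X c' 0 - X c 0‖ ^ 2 * (exp (6 * t) ^ 2 * exp (6 * t)) := by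
    intro c' hc'
    have hdist : ∀ s ∈ Icc 0 t, ‖X c' s - X c s‖ ≤ ‖X c' 0 - X c 0‖ * exp (6 * t) := by
      intro s hs
      have := dist_reduced_le (hX c' hc') (hX c hcU) (hbox c' hc') (hbox c hcU) hs.1
      rw [dist_eq_norm, dist_eq_norm] at this
      refine this.trans ?_
      gcongr
      exact hs.2
    have hderiv : ∀ s, HasDerivAt (r c') (reducedField (X c' s) - reducedField (X c s)
        - (c' - c) • reducedLinearization (X c s) (V s)) s := fun s =>
      ((hX c' hc' s).sub (hX c hcU s)).sub ((hV s).const_smul (c' - c))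
    have hg := norm_le_gronwallBound_of_norm_deriv_right_le (a := 0) (b := t) (K := 6)
      (ε := 3 * (‖X c' 0 - X c 0‖ * exp (6 * t)) ^ 2)
      (fun s _ => (hderiv s).continuousAt.continuousWithinAt)
      (fun s _ => (hderiv s).hasDerivWithinAt) le_rfl (fun s hs => ?_) t ⟨ht, le_rfl⟩
    · rw [gronwallBound_of_K_ne_0 (by norm_num), sub_zero] at hg
      refine hg.trans ?_
      have h1 := exp_pos (6 * t)
      have h2 : 0 ≤ ‖X c' 0 - X c 0‖ ^ 2 * exp (6 * t) ^ 2 := by positivity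
      have h3 : 0 ≤ ‖X c' 0 - X c 0‖ ^ 2 * exp (6 * t) ^ 2 * exp (6 * t) := by positivity
      rw [mul_pow]
      linarith
    · have hlin : reducedField (X c' s) - reducedField (X c s)
          - (c' - c) • reducedLinearization (X c s) (V s) =
          reducedLinearization (X c s) (r c' s) + (reducedField (X c' s) - reducedField (X c s)
            - reducedLinearization (X c s) (X c' s - X c s)) := by
        simp only [hr, reducedField, reducedLinearization, Prod.ext_iff, Prod.fst_sub,
          Prod.snd_sub, Prod.fst_add, Prod.snd_add, Prod.smul_fst, Prod.smul_snd, smul_eq_mul]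
        refine ⟨by ring, by ring, by ring⟩
      rw [hlin]
      refine (norm_add_le _ _).trans (add_le_add (norm_reducedLinearization_le (hbox c hcU s) _)
        ((norm_reducedField_sub_sub_le _ _).trans ?_))
      gcongr
      exact hdist s ⟨hs.1, hs.2.le⟩
  rw [hasDerivAt_iff_isLittleO] at h0 ⊢
  have hsq : (fun c' => ‖X c' 0 - X c 0‖ ^ 2) =o[𝓝 c] fun c' => c' - c := by
    have hO : (fun c' => X c' 0 - X c 0) =O[𝓝 c] fun c' => c' - c :=
      (hasDerivAt_iff_isLittleO.2 h0).isBigO_sub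
    have ho : (fun c' => ‖X c' 0 - X c 0‖) =o[𝓝 c] fun _ => (1 : ℝ) := by
      rw [Asymptotics.isLittleO_one_iff]
      have := (hasDerivAt_iff_isLittleO.2 h0).continuousAt.sub
        (continuousAt_const (y := X c 0))
      simpa [ContinuousAt] using this.norm
    simpa [sq] using hO.norm_left.mul_isLittleO ho
  refine Asymptotics.IsBigO.trans_isLittleO (g := fun c' =>
    ‖r c' 0‖ * exp (6 * t) + ‖X c' 0 - X c 0‖ ^ 2 * (exp (6 * t) ^ 2 * exp (6 * t))) ?_ ?_
  · refine Asymptotics.IsBigO.of_bound 1 ?_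
    filter_upwards [hU] with c' hc'
    rw [one_mul]
    exact (hbound c' hc').trans (le_abs_self _)
  · refine Asymptotics.IsLittleO.add ?_ ?_
    · simpa [mul_comm] using h0.norm_left.const_mul_left (exp (6 * t))
    · convert! hsq.const_mul_left (exp (6 * t) ^ 2 * exp (6 * t)) using 2
      ring

/-! The variation of the orbit with the level is elementary in `(y, z, J, t)`, `J = ∫ y²`: reduction
of order by the variation along the flow leaves `∫ (1 - z²) / z²` as the only quadrature, this
reduces to `∫ z²` by parts, and `∫ z² = t - z - 2J`. The formulas below are the result; they are
verified by differentiation. -/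

/-- The logarithmic derivative of `y` with respect to the level, times `c (1 - 4c²)`. -/
noncomputable def varLogY (c t : ℝ) : ℝ :=
  1 - 2 * c ^ 2 - orbitY c t ^ 2 + orbitZ c t * orbitJ c t - 2 * c ^ 2 * t * orbitZ c t

/-- The derivative of `z` with respect to the level, times `c (1 - 4c²)`. -/
noncomputable def varZ (c t : ℝ) : ℝ :=
  -(orbitY c t ^ 2 * orbitZ c t) + (1 - orbitZ c t ^ 2 - 2 * orbitY c t ^ 2) * orbitJ c t
    - 2 * c ^ 2 * orbitZ c t - 2 * c ^ 2 * t * (1 - orbitZ c t ^ 2 - 2 * orbitY c t ^ 2)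

/-- The derivative of `∫ y²` with respect to the level, times `c (1 - 4c²)`. -/
noncomputable def varJ (c t : ℝ) : ℝ :=
  orbitY c t ^ 2 * orbitZ c t + c ^ 2 * t * (1 - 2 * orbitY c t ^ 2)
    + orbitJ c t * (orbitY c t ^ 2 - 2 * c ^ 2)

theorem hasDerivAt_orbitY (hc : c ∈ Ioo (0 : ℝ) (1 / 2)) (t : ℝ) :
    HasDerivAt (orbitY c) (orbitY c t * orbitZ c t) t := (isBackwardOrbit_orbit hc).deriv_y t

theorem hasDerivAt_orbitZ (hc : c ∈ Ioo (0 : ℝ) (1 / 2)) (t : ℝ) :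
    HasDerivAt (orbitZ c) (1 - orbitZ c t ^ 2 - 2 * orbitY c t ^ 2) t := by
  convert! (isBackwardOrbit_orbit hc).deriv_z t using 1
  linarith [orbit_sphere hc t]

theorem orbitY_sq_mul (hc : c ∈ Ioo (0 : ℝ) (1 / 2)) (t : ℝ) :
    orbitY c t ^ 2 * (1 - orbitY c t ^ 2 - orbitZ c t ^ 2) = c ^ 2 := by
  rw [← orbit_sphere hc t]
  linear_combination (orbitX c t * orbitY c t + c) * orbitX_mul_orbitY hc t

theorem level_factor_pos (hc : c ∈ Ioo (0 : ℝ) (1 / 2)) : 0 < c * (1 - 4 * c ^ 2) := by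
  have h1 := hc.1
  have h2 := hc.2
  exact mul_pos h1 (by nlinarith)

theorem hasDerivAt_orbitY_zero_level (hc : c ∈ Ioo (0 : ℝ) (1 / 2)) :
    HasDerivAt (fun c => orbitY c 0) (orbitY c 0 * varLogY c 0 / (c * (1 - 4 * c ^ 2))) c := by
  have hp : 0 < 1 + 2 * c := by linarith [hc.1]
  have hm : 0 < 1 - 2 * c := by linarith [hc.2]
  have h2 : HasDerivAt (fun c : ℝ => 2 * c) 2 c := by
    simpa using (hasDerivAt_id c).const_mul (2 : ℝ)
  have h := ((h2.const_add 1).sqrt hp.ne').fun_sub ((h2.const_sub 1).sqrt hm.ne') |>.div_const 2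
  have heq : (fun c => (√(1 + 2 * c) - √(1 - 2 * c)) / 2) =ᶠ[𝓝 c] fun c => orbitY c 0 := by
    filter_upwards [Ioo_mem_nhds hc.1 hc.2] with c' hc'
    exact (orbitY_zero hc').symm
  refine (h.congr_of_eventuallyEq heq.symm).congr_deriv ?_
  have hc0 := hc.1.ne'
  rw [varLogY, orbitY_zero hc, orbitZ_zero hc, orbitJ_zero]
  have hsp := sqrt_pos.2 hp
  have hsm := sqrt_pos.2 hm
  have e1 := sq_sqrt hp.le
  have e2 := sq_sqrt hm.le
  set a := √(1 + 2 * c)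
  set b := √(1 - 2 * c)
  have hk : 1 - 4 * c ^ 2 = (a * b) ^ 2 := by rw [mul_pow, e1, e2]; ring
  have hnum : 1 - 2 * c ^ 2 - ((a - b) / 2) ^ 2 + 0 * 0 - 2 * c ^ 2 * 0 * 0
      = a * b * (a + b) ^ 2 / 4 := by
    linear_combination hk / 2 - (1 / 4 + a * b / 4) * (e1 + e2)
  have hl : 2 / (2 * a) - -2 / (2 * b) = (a + b) / (a * b) := by
    field_simp
    ring
  rw [hnum, hk, hl]
  field_simp
  linear_combination e2 - e1

theorem hasDerivAt_reducedOrbit_level (hc : c ∈ Ioo (0 : ℝ) (1 / 2)) {t : ℝ} (ht : 0 ≤ t) :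
    HasDerivAt (fun c => reducedOrbit c t)
      (orbitY c t * varLogY c t / (c * (1 - 4 * c ^ 2)), varZ c t / (c * (1 - 4 * c ^ 2)),
        varJ c t / (c * (1 - 4 * c ^ 2))) c := by
  refine hasDerivAt_level_of_linearization (X := reducedOrbit)
    (V := fun t => (orbitY c t * varLogY c t / (c * (1 - 4 * c ^ 2)),
      varZ c t / (c * (1 - 4 * c ^ 2)), varJ c t / (c * (1 - 4 * c ^ 2))))
    (Ioo_mem_nhds hc.1 hc.2) (fun c' hc' => hasDerivAt_reducedOrbit hc')
    (fun c' hc' => reducedOrbit_mem_reducedBox hc') (fun s => ?_) ?_ ht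
  · have hk := (level_factor_pos hc).ne'
    have hy := hasDerivAt_orbitY hc s
    have hz := hasDerivAt_orbitZ hc s
    have hj := hasDerivAt_orbitJ hc s
    have hid := (hasDerivAt_id s).const_mul (2 * c ^ 2)
    have hid' := (hasDerivAt_id s).const_mul (c ^ 2)
    have hinv := orbitY_sq_mul hc s
    have hq := ((hz.fun_pow 2).const_sub 1).fun_sub ((hy.fun_pow 2).const_mul 2)
    have h1 := hy.fun_mul ((((hy.fun_pow 2).const_sub (1 - 2 * c ^ 2)).fun_add
      (hz.fun_mul hj)).fun_sub (hid.fun_mul hz)) |>.div_const (c * (1 - 4 * c ^ 2))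
    have h2 := ((((hy.fun_pow 2).fun_mul hz).fun_neg.fun_add (hq.fun_mul hj)).fun_sub
      (hz.const_mul (2 * c ^ 2))).fun_sub (hid.fun_mul hq) |>.div_const (c * (1 - 4 * c ^ 2))
    have h3 := (((hy.fun_pow 2).fun_mul hz).fun_add
      (hid'.fun_mul (((hy.fun_pow 2).const_mul 2).const_sub 1))).fun_add
      (hj.fun_mul ((hy.fun_pow 2).sub_const (2 * c ^ 2))) |>.div_const (c * (1 - 4 * c ^ 2))
    refine (h1.prodMk (h2.prodMk h3)).congr_deriv ?_
    simp only [reducedLinearization, reducedOrbit, varLogY, varZ, Prod.mk.injEq, id]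
    push_cast
    generalize orbitY c s = y at *
    generalize orbitZ c s = z at *
    generalize orbitJ c s = j at *
    refine ⟨?_, ?_, ?_⟩
    · field_simp
      ring
    · linear_combination 4 / (c * (1 - 4 * c ^ 2)) * hinv
    · linear_combination -1 / (c * (1 - 4 * c ^ 2)) * hinv
  · have hev : (fun c => (orbitY c 0, (0 : ℝ), (0 : ℝ))) =ᶠ[𝓝 c] fun c => reducedOrbit c 0 := by
      filter_upwards [Ioo_mem_nhds hc.1 hc.2] with c' hc'
      rw [reducedOrbit, orbitZ_zero hc', orbitJ_zero]
    have hv : varZ c 0 = 0 ∧ varJ c 0 = 0 := by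
      simp [varZ, varJ, orbitZ_zero hc, orbitJ_zero]
    simp only [hv.1, hv.2, zero_div]
    exact ((hasDerivAt_orbitY_zero_level hc).prodMk
      ((hasDerivAt_const c (0 : ℝ)).prodMk (hasDerivAt_const c (0 : ℝ)))).congr_of_eventuallyEq
        hev.symm

theorem hasDerivAt_orbitY_level (hc : c ∈ Ioo (0 : ℝ) (1 / 2)) {t : ℝ} (ht : 0 ≤ t) :
    HasDerivAt (fun c => orbitY c t) (orbitY c t * varLogY c t / (c * (1 - 4 * c ^ 2))) c :=
  (hasDerivAt_reducedOrbit_level hc ht).hasFDerivAt.fst.hasDerivAt.congr_deriv (by simp)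

theorem hasDerivAt_orbitZ_level (hc : c ∈ Ioo (0 : ℝ) (1 / 2)) {t : ℝ} (ht : 0 ≤ t) :
    HasDerivAt (fun c => orbitZ c t) (varZ c t / (c * (1 - 4 * c ^ 2))) c :=
  (hasDerivAt_reducedOrbit_level hc ht).hasFDerivAt.snd.fst.hasDerivAt.congr_deriv (by simp)

theorem hasDerivAt_orbitJ_level (hc : c ∈ Ioo (0 : ℝ) (1 / 2)) {t : ℝ} (ht : 0 ≤ t) :
    HasDerivAt (fun c => orbitJ c t) (varJ c t / (c * (1 - 4 * c ^ 2))) c :=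
  (hasDerivAt_reducedOrbit_level hc ht).hasFDerivAt.snd.snd.hasDerivAt.congr_deriv (by simp)

/-- The function whose sign is that of the derivative of `b` with respect to the period. -/
noncomputable def signFn (c t : ℝ) : ℝ :=
  orbitZ c t * (orbitJ c t ^ 2 - 2 * (c ^ 2 * t) * orbitJ c t - orbitY c t ^ 2)
    + (1 - 2 * orbitY c t ^ 2) * (orbitJ c t - c ^ 2 * t)

theorem hasDerivAt_orbitJ_div_orbitY_level (hc : c ∈ Ioo (0 : ℝ) (1 / 2)) {t : ℝ} (ht : 0 ≤ t) :
    HasDerivAt (fun c => orbitJ c t / orbitY c t)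
      (-(signFn c t / (c * (1 - 4 * c ^ 2) * orbitY c t))) c := by
  have hY := hasDerivAt_orbitY_level hc ht
  have hJ := hasDerivAt_orbitJ_level hc ht
  have hy := (orbitY_pos hc t).ne'
  refine (hJ.fun_div hY hy).congr_deriv ?_
  have hk := (level_factor_pos hc).ne'
  rw [varJ, varLogY, signFn]
  generalize c * (1 - 4 * c ^ 2) = k at *
  field_simp
  ring

theorem hasDerivAt_signFn_level (hc : c ∈ Ioo (0 : ℝ) (1 / 2)) {t : ℝ} (ht : 0 ≤ t) :
    HasDerivAt (fun c => signFn c t)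
      (((orbitJ c t ^ 2 - 2 * (c ^ 2 * t) * orbitJ c t - orbitY c t ^ 2) * varZ c t
        + (2 * orbitZ c t * (orbitJ c t - c ^ 2 * t) + (1 - 2 * orbitY c t ^ 2)) * varJ c t
        - 2 * (c ^ 2 * t) * (1 - 4 * c ^ 2)
          * (2 * orbitZ c t * orbitJ c t + (1 - 2 * orbitY c t ^ 2))
        - 2 * orbitY c t ^ 2 * (orbitZ c t + 2 * (orbitJ c t - c ^ 2 * t)) * varLogY c t)
        / (c * (1 - 4 * c ^ 2))) c := by
  have hY := hasDerivAt_orbitY_level hc ht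
  have hZ := hasDerivAt_orbitZ_level hc ht
  have hJ := hasDerivAt_orbitJ_level hc ht
  have hw : HasDerivAt (fun c : ℝ => c ^ 2 * t) (2 * c * t) c := by
    simpa using (hasDerivAt_pow 2 c).mul_const t
  have hsum := (hZ.fun_mul (((hJ.fun_pow 2).fun_sub ((hw.const_mul 2).fun_mul hJ)).fun_sub
    (hY.fun_pow 2))).fun_add
      ((((hY.fun_pow 2).const_mul 2).const_sub 1).fun_mul (hJ.fun_sub hw))
  refine hsum.congr_deriv ?_
  have hk := (level_factor_pos hc).ne'
  have hc0 := hc.1.ne'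
  have hk' : 1 - 4 * c ^ 2 ≠ 0 := right_ne_zero_of_mul hk
  push_cast
  generalize varZ c t = vz
  generalize varJ c t = vj
  generalize varLogY c t = vy
  generalize 1 - 4 * c ^ 2 = k at *
  field_simp
  ring

theorem hasDerivAt_signFn (hc : c ∈ Ioo (0 : ℝ) (1 / 2)) (t : ℝ) :
    HasDerivAt (signFn c)
      ((1 - orbitZ c t ^ 2 - 2 * orbitY c t ^ 2)
          * (orbitJ c t ^ 2 - 2 * (c ^ 2 * t) * orbitJ c t - orbitY c t ^ 2)
        + orbitZ c t * (2 * orbitJ c t * orbitY c t ^ 2 - 2 * c ^ 2 * orbitJ c t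
          - 2 * (c ^ 2 * t) * orbitY c t ^ 2 - 2 * orbitY c t ^ 2 * orbitZ c t)
        + (1 - 2 * orbitY c t ^ 2) * (orbitY c t ^ 2 - c ^ 2)
        - 4 * orbitY c t ^ 2 * orbitZ c t * (orbitJ c t - c ^ 2 * t)) t := by
  have hY := hasDerivAt_orbitY hc t
  have hZ := hasDerivAt_orbitZ hc t
  have hJ := hasDerivAt_orbitJ hc t
  have hw : HasDerivAt (fun t : ℝ => c ^ 2 * t) (c ^ 2) t := by
    simpa using (hasDerivAt_id t).const_mul (c ^ 2)
  have hsum := (hZ.fun_mul (((hJ.fun_pow 2).fun_sub ((hw.const_mul 2).fun_mul hJ)).fun_sub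
    (hY.fun_pow 2))).fun_add
      ((((hY.fun_pow 2).const_mul 2).const_sub 1).fun_mul (hJ.fun_sub hw))
  refine hsum.congr_deriv ?_
  push_cast
  ring

/-! ### Sign estimates -/

/-- The value of `signFn` in terms of `(z, y², ∫ y², c² t)`. -/
def signPoly (z u j w : ℝ) : ℝ := z * (j ^ 2 - 2 * w * j - u) + (1 - 2 * u) * (j - w)

/-- Where `x` is at most `1/3`, the sign is read off after `∫ y² = ∫ x² - z` is substituted. -/
theorem signPoly_neg_of_x_le {x z u j w : ℝ} (hx0 : 0 ≤ x) (hx : x ≤ 1 / 3) (hu : 0 ≤ u)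
    (hsph : x ^ 2 + u + z ^ 2 = 1) (hz : z ≤ 0) (hw0 : 0 ≤ w) (hw : w ≤ 1 / 10 ^ 8)
    (hk : 99 / 100 ≤ j + z) (hj : j ≤ 201 / 100) : signPoly z u j w < 0 := by
  have hz1 : -1 ≤ z := by nlinarith
  -- With `k = j + z`, both `k² - x²` and `(1 - 2x²) k` are nonnegative.
  have heq : signPoly z u j w = z * ((j + z) ^ 2 - x ^ 2) - (1 - 2 * x ^ 2) * (j + z)
      + w * (2 * ((-z) * j) - (1 - 2 * u)) := by
    unfold signPoly
    linear_combination (-z - 2 * j) * hsph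
  have h1 : 0 ≤ (-z) * ((j + z) ^ 2 - x ^ 2) := mul_nonneg (by linarith) (by nlinarith)
  have h2 : 7 / 9 * (99 / 100) ≤ (1 - 2 * x ^ 2) * (j + z) :=
    mul_le_mul (by nlinarith) hk (by norm_num) (by nlinarith)
  have h3 : (-z) * j ≤ 1 * (201 / 100) := mul_le_mul (by linarith) hj (by linarith) (by norm_num)
  have h4 : w * (2 * ((-z) * j) - (1 - 2 * u)) ≤ 1 / 10 ^ 8 * 10 := by
    have h5 : u ≤ 1 := by nlinarith
    have h6 : 2 * ((-z) * j) - (1 - 2 * u) ≤ 10 := by linarith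
    nlinarith
  rw [heq]
  norm_num at h2 h4
  linarith

theorem signPoly_neg_of_z_le {z u j w : ℝ} (hz : z ≤ -(3 / 5)) (hu0 : 0 ≤ u)
    (hu : u ≤ 1 / 10 ^ 10) (hw0 : 0 ≤ w) (hw : w ≤ 1 / 10 ^ 8)
    (hj : 199 / 100 ≤ j) (hj' : j ≤ 201 / 100) : signPoly z u j w < 0 := by
  unfold signPoly
  norm_num at hu hw
  have hwj : w * j ≤ 1 / 100000000 * (201 / 100) := mul_le_mul hw hj' (by linarith) (by norm_num)
  have h1 : 0 ≤ (-z - 3 / 5) * (j ^ 2 - 2 * w * j - u) :=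
    mul_nonneg (by linarith) (by nlinarith)
  have h2 : 0 ≤ u * (j - w) := mul_nonneg hu0 (by linarith)
  have h3 : 0 ≤ (j - 199 / 100) * (3 / 5 * j + 97 / 500) := mul_nonneg (by linarith) (by linarith)
  nlinarith

/-- The time derivative of `signFn` is positive where `y²` is negligible against `x² = q + y²`. -/
theorem deriv_signFn_pos_aux {z q u j w d : ℝ} (hz0 : z ≤ 0) (hz1 : -1 ≤ z)
    (hq : q = 1 - z ^ 2 - 2 * u) (hq0 : 1 / 10 ≤ q) (hu0 : 0 ≤ u) (hu : u ≤ 1 / 10 ^ 10)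
    (hd0 : 0 ≤ d) (hd : d ≤ 1 / 10 ^ 10) (hw0 : 0 ≤ w) (hw : w ≤ 1 / 10 ^ 8)
    (hj : 199 / 100 ≤ j) (hj' : j ≤ 201 / 100) :
    0 < (1 - z ^ 2 - 2 * u) * (j ^ 2 - 2 * w * j - u)
        + z * (2 * j * u - 2 * d * j - 2 * w * u - 2 * u * z)
        + (1 - 2 * u) * (u - d) - 4 * u * z * (j - w) := by
  norm_num at hu hd hw
  rw [← hq]
  have hwj : w * j ≤ 1 / 100000000 * (201 / 100) := mul_le_mul hw hj' (by linarith) (by norm_num)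
  have h1 : 1 / 10 * 3 ≤ q * (j ^ 2 - 2 * w * j - u) :=
    mul_le_mul hq0 (by nlinarith) (by norm_num) (by linarith)
  have huj : u * j ≤ 1 / 10000000000 * (201 / 100) := mul_le_mul hu hj' (by linarith) (by norm_num)
  have huj0 : 0 ≤ u * j := mul_nonneg hu0 (by linarith)
  have h2 : (-z) * (u * j) ≤ 1 * (u * j) := mul_le_mul_of_nonneg_right (by linarith) huj0
  have h3 : 0 ≤ (-z) * (d * j) := mul_nonneg (by linarith) (mul_nonneg hd0 (by linarith))
  have h4 : 0 ≤ (-z) * (w * u) := mul_nonneg (by linarith) (mul_nonneg hw0 hu0)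
  have h5 : z ^ 2 * u ≤ 1 * u := mul_le_mul_of_nonneg_right (by nlinarith) hu0
  have h6 : 0 ≤ u * (-z) * (j - w) :=
    mul_nonneg (mul_nonneg hu0 (by linarith)) (by linarith)
  have h7 : 0 ≤ u * d := mul_nonneg hu0 hd0
  have h8 : u * u ≤ 1 * u := mul_le_mul_of_nonneg_right (by linarith) hu0
  linarith

theorem abs_mul_le_of_abs_le {a b A B : ℝ} (ha : |a| ≤ A) (hb : |b| ≤ B) : |a * b| ≤ A * B := by
  rw [abs_mul]
  exact mul_le_mul ha hb (abs_nonneg _) ((abs_nonneg _).trans ha)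

/-- The derivative of `signFn` in the level is positive where `y²` is negligible against
`x² = q + y²`: its dominant term is `j³ q`. -/
theorem deriv_signFn_level_pos_aux {z q u j w d : ℝ} (hz0 : z ≤ 0) (hz1 : -1 ≤ z)
    (hq : q = 1 - z ^ 2 - 2 * u) (hq0 : 1 / 10 ≤ q) (hu0 : 0 ≤ u) (hu : u ≤ 1 / 10 ^ 10)
    (hd0 : 0 ≤ d) (hd : d ≤ 1 / 10 ^ 10) (hw0 : 0 ≤ w) (hw : w ≤ 1 / 10 ^ 8)
    (hj : 199 / 100 ≤ j) (hj' : j ≤ 201 / 100) :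
    0 < (j ^ 2 - 2 * w * j - u)
          * (-(u * z) + (1 - z ^ 2 - 2 * u) * j - 2 * d * z - 2 * w * (1 - z ^ 2 - 2 * u))
        + (2 * z * (j - w) + (1 - 2 * u)) * (u * z + w * (1 - 2 * u) + j * (u - 2 * d))
        - 2 * w * (1 - 4 * d) * (2 * z * j + (1 - 2 * u))
        - 2 * u * (z + 2 * (j - w)) * (1 - 2 * d - u + z * j - 2 * w * z) := by
  norm_num at hu hd hw
  rw [← hq]
  have hq1 : q ≤ 1 := by rw [hq]; nlinarith
  have hwj : w * j ≤ 1 / 100000000 * (201 / 100) := mul_le_mul hw hj' (by linarith) (by norm_num)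
  have huz : 0 ≤ u * (-z) := mul_nonneg hu0 (by linarith)
  have huz' : u * (-z) ≤ u * 1 := mul_le_mul_of_nonneg_left (by linarith) hu0
  have hdz : 0 ≤ d * (-z) := mul_nonneg hd0 (by linarith)
  have hzj : 0 ≤ (-z) * j := mul_nonneg (by linarith) (by linarith)
  have hzj' : (-z) * j ≤ 1 * (201 / 100) := mul_le_mul (by linarith) hj' (by linarith) (by norm_num)
  have hzw : 0 ≤ (-z) * w := mul_nonneg (by linarith) hw0
  have hzw' : (-z) * w ≤ 1 * w := mul_le_mul_of_nonneg_right (by linarith) hw0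
  have hqj : 1 / 10 * (199 / 100) ≤ q * j := mul_le_mul hq0 hj (by norm_num) (by linarith)
  have hwq : w * q ≤ w * 1 := mul_le_mul_of_nonneg_left hq1 hw0
  have hwu : 0 ≤ w * u := mul_nonneg hw0 hu0
  have hwu' : w * u ≤ w * 1 := mul_le_mul_of_nonneg_left (by linarith) hw0
  have huj0 : 0 ≤ u * j := mul_nonneg hu0 (by linarith)
  have huj : u * j ≤ 1 / 10000000000 * (201 / 100) := mul_le_mul hu hj' (by linarith) (by norm_num)
  have hdj0 : 0 ≤ d * j := mul_nonneg hd0 (by linarith)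
  have hdj : d * j ≤ 1 / 10000000000 * (201 / 100) := mul_le_mul hd hj' (by linarith) (by norm_num)
  have hjj : 199 / 100 * (199 / 100) ≤ j * j := mul_le_mul hj hj (by norm_num) (by linarith)
  have h1 : 3 * (1 / 10) ≤ (j ^ 2 - 2 * w * j - u) * (-(u * z) + q * j - 2 * d * z - 2 * w * q) :=
    mul_le_mul (by linarith) (by linarith) (by norm_num) (by linarith)
  have e1 : |2 * z * (j - w) + (1 - 2 * u)| ≤ 10 := abs_le.2 ⟨by linarith, by linarith⟩
  have e2 : |u * z + w * (1 - 2 * u) + j * (u - 2 * d)| ≤ 1 / 1000 :=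
    abs_le.2 ⟨by linarith, by linarith⟩
  have e3 : |2 * w * (1 - 4 * d)| ≤ 1 / 1000 := by
    rw [abs_of_nonneg (mul_nonneg (by linarith) (by linarith))]
    linarith [mul_nonneg hw0 hd0]
  have e4 : |2 * z * j + (1 - 2 * u)| ≤ 10 := abs_le.2 ⟨by linarith, by linarith⟩
  have e5 : |2 * u * (z + 2 * (j - w))| ≤ 1 / 1000 := abs_le.2 ⟨by linarith, by linarith⟩
  have e6 : |1 - 2 * d - u + z * j - 2 * w * z| ≤ 10 := abs_le.2 ⟨by linarith, by linarith⟩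
  have h2 := abs_mul_le_of_abs_le e1 e2
  have h3 := abs_mul_le_of_abs_le e3 e4
  have h4 := abs_mul_le_of_abs_le e5 e6
  rw [abs_le] at h2 h3 h4
  linarith

/-! ### Orbits of small level -/

theorem sub_le_mul_of_hasDerivAt_le {f f' : ℝ → ℝ} {a b C : ℝ} (hab : a ≤ b)
    (hf : ∀ t, HasDerivAt f (f' t) t) (hle : ∀ t ∈ Icc a b, f' t ≤ C) :
    f b - f a ≤ C * (b - a) := by
  refine (convex_Icc a b).image_sub_le_mul_sub_of_deriv_le
    (fun t _ => (hf t).continuousAt.continuousWithinAt)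
    (fun t _ => (hf t).differentiableAt.differentiableWithinAt) (fun t ht => ?_)
    a ⟨le_rfl, hab⟩ b ⟨hab, le_rfl⟩ hab
  rw [(hf t).deriv]
  exact hle t (interior_subset ht)

theorem hasDerivAt_orbitJ_add_orbitZ (hc : c ∈ Ioo (0 : ℝ) (1 / 2)) (t : ℝ) :
    HasDerivAt (fun t => orbitJ c t + orbitZ c t) (orbitX c t ^ 2) t := by
  refine ((hasDerivAt_orbitJ hc t).fun_add (hasDerivAt_orbitZ hc t)).congr_deriv ?_
  linarith [orbit_sphere hc t]

theorem monotone_orbitJ (hc : c ∈ Ioo (0 : ℝ) (1 / 2)) : Monotone (orbitJ c) :=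
  monotone_of_hasDerivAt_nonneg (hasDerivAt_orbitJ hc) fun _ => sq_nonneg _

theorem monotone_orbitJ_add_orbitZ (hc : c ∈ Ioo (0 : ℝ) (1 / 2)) :
    Monotone fun t => orbitJ c t + orbitZ c t :=
  monotone_of_hasDerivAt_nonneg (hasDerivAt_orbitJ_add_orbitZ hc) fun _ => sq_nonneg _

theorem orbitY_le_orbitX {t : ℝ} (h : 0 ≤ cos (amplitude c t)) : orbitY c t ≤ orbitX c t := by
  have := mul_nonneg (sqrt_nonneg (1 - 2 * c)) h
  unfold orbitX orbitY
  linarith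

theorem orbitX_le_orbitY {t : ℝ} (h : cos (amplitude c t) ≤ 0) : orbitX c t ≤ orbitY c t := by
  have := mul_nonneg (sqrt_nonneg (1 - 2 * c)) (neg_nonneg.2 h)
  unfold orbitX orbitY
  linarith

theorem orbitY_sq_le (hc : c ∈ Ioo (0 : ℝ) (1 / 2)) {t : ℝ}
    (h : 0 ≤ cos (amplitude c t)) : orbitY c t ^ 2 ≤ c := by
  calc orbitY c t ^ 2 = orbitY c t * orbitY c t := sq _
    _ ≤ orbitX c t * orbitY c t :=
      mul_le_mul_of_nonneg_right (orbitY_le_orbitX h) (orbitY_pos hc t).le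
    _ = c := orbitX_mul_orbitY hc t

theorem orbitX_sq_le (hc : c ∈ Ioo (0 : ℝ) (1 / 2)) {t : ℝ}
    (h : cos (amplitude c t) ≤ 0) : orbitX c t ^ 2 ≤ c := by
  calc orbitX c t ^ 2 = orbitX c t * orbitX c t := sq _
    _ ≤ orbitX c t * orbitY c t :=
      mul_le_mul_of_nonneg_left (orbitX_le_orbitY h) (orbitX_pos hc t).le
    _ = c := orbitX_mul_orbitY hc t

theorem amplitude_le_iff (hc : c ∈ Ioo (0 : ℝ) (1 / 2)) {t φ : ℝ} :
    amplitude c t ≤ φ ↔ t ≤ travelTime c φ := by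
  rw [← (strictMono_travelTime hc).le_iff_le, travelTime_amplitude hc]

theorem le_amplitude_iff (hc : c ∈ Ioo (0 : ℝ) (1 / 2)) {t φ : ℝ} :
    φ ≤ amplitude c t ↔ travelTime c φ ≤ t := by
  rw [← (strictMono_travelTime hc).le_iff_le, travelTime_amplitude hc]

theorem cos_nonneg_of_three_pi_div_two_le {φ : ℝ} (h1 : π / 2 + π ≤ φ) (h2 : φ ≤ 2 * π) :
    0 ≤ cos φ := by
  rw [← cos_sub_two_pi]
  exact cos_nonneg_of_neg_pi_div_two_le_of_le (by linarith) (by linarith [pi_pos])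

theorem orbitZ_travelTime_pi_div_two (hc : c ∈ Ioo (0 : ℝ) (1 / 2)) :
    orbitZ c (travelTime c (π / 2)) = √(1 - 2 * c) := by
  simp [orbitZ, amplitude_travelTime hc]

theorem orbitZ_travelTime_three_pi_div_two (hc : c ∈ Ioo (0 : ℝ) (1 / 2)) :
    orbitZ c (travelTime c (π / 2 + π)) = -√(1 - 2 * c) := by
  simp [orbitZ, amplitude_travelTime hc, sin_add_pi]

theorem travelTime_pi_div_two_nonneg (hc : c ∈ Ioo (0 : ℝ) (1 / 2)) :
    0 ≤ travelTime c (π / 2) := by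
  rw [← travelTime_zero c]
  exact (strictMono_travelTime hc).monotone (by positivity)

/-- After the first quarter, `∫ x² = ∫ y² + z` has reached `√(1 - 2c)`. -/
theorem sqrt_le_orbitJ_add_orbitZ (hc : c ∈ Ioo (0 : ℝ) (1 / 2)) {t : ℝ}
    (ht : travelTime c (π / 2) ≤ t) : √(1 - 2 * c) ≤ orbitJ c t + orbitZ c t := by
  have h1 := monotone_orbitJ_add_orbitZ hc ht
  have h2 := monotone_orbitJ hc (travelTime_pi_div_two_nonneg hc)
  simp only [orbitZ_travelTime_pi_div_two hc] at h1
  rw [orbitJ_zero] at h2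
  linarith

/-- In the last quarter, `∫ y²` is at least `2 √(1 - 2c)`. -/
theorem two_mul_sqrt_le_orbitJ (hc : c ∈ Ioo (0 : ℝ) (1 / 2)) {t : ℝ}
    (ht : travelTime c (π / 2 + π) ≤ t) : 2 * √(1 - 2 * c) ≤ orbitJ c t := by
  have h1 := monotone_orbitJ hc ht
  have h2 := sqrt_le_orbitJ_add_orbitZ hc
    ((strictMono_travelTime hc).monotone (by linarith [pi_pos] : π / 2 ≤ π / 2 + π))
  rw [orbitZ_travelTime_three_pi_div_two hc] at h2
  linarith

/-- `∫ y²` and `∫ x²` grow at rate at most `c` on the parts of the loop where `y`, respectively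
`x`, is the smaller coordinate. -/
theorem orbitJ_period_le (hc : c ∈ Ioo (0 : ℝ) (1 / 2)) :
    orbitJ c (loopPeriod c) ≤ 2 * √(1 - 2 * c) + c * loopPeriod c := by
  have hmono := (strictMono_travelTime hc).monotone
  have hpi := pi_pos
  have h1 := sub_le_mul_of_hasDerivAt_le (C := c) (travelTime_pi_div_two_nonneg hc)
    (hasDerivAt_orbitJ hc) fun t ht => by
      refine orbitY_sq_le hc (cos_nonneg_of_neg_pi_div_two_le_of_le ?_
        ((amplitude_le_iff hc).2 ht.2))
      have h0 : 0 ≤ amplitude c t := (le_amplitude_iff hc).2 (by simpa [travelTime_zero] using ht.1)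
      linarith
  have h2 := sub_le_mul_of_hasDerivAt_le (C := c)
    (hmono (by linarith : π / 2 ≤ π / 2 + π))
    (hasDerivAt_orbitJ_add_orbitZ hc) fun t ht =>
      orbitX_sq_le hc (cos_nonpos_of_pi_div_two_le_of_le
        ((le_amplitude_iff hc).2 ht.1) (by linarith [(amplitude_le_iff hc).2 ht.2]))
  have h3 := sub_le_mul_of_hasDerivAt_le (C := c)
    (hmono (by linarith : π / 2 + π ≤ 2 * π)) (hasDerivAt_orbitJ hc) fun t ht =>
      orbitY_sq_le hc (cos_nonneg_of_three_pi_div_two_le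
        ((le_amplitude_iff hc).2 ht.1) ((amplitude_le_iff hc).2 ht.2))
  simp only [orbitJ_zero, orbitZ_travelTime_pi_div_two hc,
    orbitZ_travelTime_three_pi_div_two hc] at h1 h2 h3
  change orbitJ c (travelTime c (2 * π)) ≤ 2 * √(1 - 2 * c) + c * travelTime c (2 * π)
  linarith

theorem orbitZ_nonpos (hc : c ∈ Ioo (0 : ℝ) (1 / 2)) {t : ℝ}
    (ht : t ∈ Icc (loopPeriod c / 2) (loopPeriod c)) : orbitZ c t ≤ 0 := by
  rw [← travelTime_pi hc] at ht
  have h1 := (le_amplitude_iff hc).2 ht.1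
  have h2 := (amplitude_le_iff hc).2 ht.2
  have h3 := sin_nonneg_of_nonneg_of_le_pi (by linarith : 0 ≤ amplitude c t - π) (by linarith)
  rw [sin_sub_pi] at h3
  exact mul_nonpos_of_nonneg_of_nonpos (sqrt_nonneg _) (by linarith)

theorem neg_one_le_orbitZ (hc : c ∈ Ioo (0 : ℝ) (1 / 2)) (t : ℝ) : -1 ≤ orbitZ c t := by
  have := orbit_sphere hc t
  nlinarith [sq_nonneg (orbitX c t), sq_nonneg (orbitY c t)]

theorem monotoneOn_orbitX (hc : c ∈ Ioo (0 : ℝ) (1 / 2)) :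
    MonotoneOn (orbitX c) (Icc (loopPeriod c / 2) (loopPeriod c)) := by
  have h := (isBackwardOrbit_orbit hc).deriv_x
  refine monotoneOn_of_deriv_nonneg (convex_Icc _ _)
    (fun t _ => (h t).continuousAt.continuousWithinAt)
    (fun t _ => (h t).differentiableAt.differentiableWithinAt) fun t ht => ?_
  rw [(h t).deriv]
  have h1 := orbitZ_nonpos hc (interior_subset ht)
  have h2 := orbitX_pos hc t
  nlinarith

theorem mem_of_small (hc : c ∈ Ioo (0 : ℝ) (1 / 10 ^ 6)) : c ∈ Ioo (0 : ℝ) (1 / 2) :=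
  ⟨hc.1, hc.2.trans (by norm_num)⟩

theorem sqrt_ge_of_small (hc : c ∈ Ioo (0 : ℝ) (1 / 10 ^ 6)) : 999 / 1000 ≤ √(1 - 2 * c) := by
  refine le_sqrt_of_sq_le ?_
  have := hc.2
  norm_num at *
  linarith

theorem mul_loopPeriod_le (hc : c ∈ Ioo (0 : ℝ) (1 / 10 ^ 6)) : c * loopPeriod c ≤ 1 / 250 := by
  have h0 := hc.1
  have h1 := loopPeriod_le (mem_of_small hc)
  have h2 : √c ≤ 1 / 1000 := sqrt_le_iff.2 ⟨by norm_num, by have := hc.2; norm_num at *; linarith⟩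
  have h3 := sqrt_pos.2 h0
  calc c * loopPeriod c ≤ c * (π / √c) := mul_le_mul_of_nonneg_left h1 h0.le
    _ = √c * π := by
      nth_rewrite 1 [← sq_sqrt h0.le]
      field_simp
    _ ≤ 1 / 1000 * 4 := mul_le_mul h2 pi_lt_four.le pi_pos.le (by norm_num)
    _ = 1 / 250 := by norm_num

theorem two_le_loopPeriod (hc : c ∈ Ioo (0 : ℝ) (1 / 10 ^ 6)) : 2 ≤ loopPeriod c := by
  by_contra! h
  have h1 := one_le_two_mul_exp_loopPeriod (mem_of_small hc)
  have h2 : exp (2 * loopPeriod c) ≤ exp 1 ^ 4 := by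
    rw [← exp_nat_mul]
    exact exp_le_exp.2 (by push_cast; linarith)
  have h3 : exp 1 ^ 4 ≤ 3 ^ 4 := by
    have := exp_one_lt_d9
    gcongr
    linarith
  have h4 : 2 * c * exp (2 * loopPeriod c) ≤ 2 * (1 / 10 ^ 6) * 3 ^ 4 := by
    have := hc.2
    gcongr
    exact h2.trans h3
  norm_num at h4
  linarith

/-- Bounds valid on the whole second half of the loop, for small levels. -/
theorem bounds_of_half_period_le (hc : c ∈ Ioo (0 : ℝ) (1 / 10 ^ 6)) {t : ℝ}
    (ht : t ∈ Icc (loopPeriod c / 2) (loopPeriod c)) :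
    0 ≤ c ^ 2 * t ∧ c ^ 2 * t ≤ 1 / 10 ^ 8 ∧ 99 / 100 ≤ orbitJ c t + orbitZ c t ∧
      orbitJ c t ≤ 201 / 100 := by
  have hc' := mem_of_small hc
  have h0 := hc.1
  have hL := mul_loopPeriod_le hc
  have hp := loopPeriod_pos hc'
  have ht0 : 0 ≤ t := by linarith [ht.1]
  have hα := sqrt_ge_of_small hc
  refine ⟨by positivity, ?_, ?_, ?_⟩
  · calc c ^ 2 * t ≤ c ^ 2 * loopPeriod c := mul_le_mul_of_nonneg_left ht.2 (by positivity)
      _ = c * (c * loopPeriod c) := by ring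
      _ ≤ 1 / 10 ^ 6 * (1 / 250) := mul_le_mul hc.2.le hL (by positivity) (by norm_num)
      _ ≤ 1 / 10 ^ 8 := by norm_num
  · have h1 : travelTime c (π / 2) ≤ t := by
      refine le_trans ?_ ht.1
      rw [← travelTime_pi hc']
      exact (strictMono_travelTime hc').monotone (by linarith [pi_pos])
    linarith [sqrt_le_orbitJ_add_orbitZ hc' h1]
  · have h1 := monotone_orbitJ hc' ht.2
    have h2 := orbitJ_period_le hc'
    have h3 : √(1 - 2 * c) ≤ 1 := sqrt_le_one.2 (by linarith)
    linarith

/-- Further bounds where `x` is not small; there the loop is in its last quarter. -/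
theorem bounds_of_x_ge (hc : c ∈ Ioo (0 : ℝ) (1 / 10 ^ 6)) {t : ℝ}
    (ht : t ∈ Icc (loopPeriod c / 2) (loopPeriod c)) (hx : 1 / 3 ≤ orbitX c t) :
    orbitY c t ^ 2 ≤ 1 / 10 ^ 10 ∧ 199 / 100 ≤ orbitJ c t ∧
      1 / 10 ≤ 1 - orbitZ c t ^ 2 - 2 * orbitY c t ^ 2 := by
  have hc' := mem_of_small hc
  have hy := orbitY_pos hc' t
  have hxy := orbitX_mul_orbitY hc' t
  have hy' : orbitY c t ≤ 3 / 10 ^ 6 := by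
    have := hc.2
    have : 1 / 3 * orbitY c t ≤ orbitX c t * orbitY c t := mul_le_mul_of_nonneg_right hx hy.le
    norm_num at *
    linarith
  have hu : orbitY c t ^ 2 ≤ 1 / 10 ^ 10 := by
    calc orbitY c t ^ 2 ≤ (3 / 10 ^ 6) ^ 2 := by gcongr
      _ ≤ _ := by norm_num
  refine ⟨hu, ?_, ?_⟩
  · have h3 : travelTime c (π / 2 + π) ≤ t := by
      by_contra! h
      have h1 : π ≤ amplitude c t := by
        rw [le_amplitude_iff hc', travelTime_pi hc']
        exact ht.1
      have h2 := (amplitude_le_iff hc').2 h.le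
      have h4 := orbitX_le_orbitY (c := c) (t := t)
        (cos_nonpos_of_pi_div_two_le_of_le (by linarith [pi_pos]) (by linarith))
      norm_num at *
      linarith
    have := two_mul_sqrt_le_orbitJ hc' h3
    have := sqrt_ge_of_small hc
    linarith
  · have := orbit_sphere hc' t
    norm_num at *
    nlinarith

theorem signFn_neg_of_x_le (hc : c ∈ Ioo (0 : ℝ) (1 / 10 ^ 6)) {t : ℝ}
    (ht : t ∈ Icc (loopPeriod c / 2) (loopPeriod c)) (hx : orbitX c t ≤ 1 / 3) :
    signFn c t < 0 := by
  have hc' := mem_of_small hc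
  obtain ⟨h1, h2, h3, h4⟩ := bounds_of_half_period_le hc ht
  exact signPoly_neg_of_x_le (orbitX_pos hc' t).le hx (sq_nonneg _) (orbit_sphere hc' t)
    (orbitZ_nonpos hc' ht) h1 h2 h3 h4

theorem sq_le_of_small (hc : c ∈ Ioo (0 : ℝ) (1 / 10 ^ 6)) : c ^ 2 ≤ 1 / 10 ^ 10 := by
  have h0 := hc.1
  have h1 := hc.2
  calc c ^ 2 ≤ (1 / 10 ^ 6) ^ 2 := by gcongr
    _ ≤ _ := by norm_num

theorem strictMonoOn_signFn (hc : c ∈ Ioo (0 : ℝ) (1 / 10 ^ 6)) {s : ℝ}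
    (hs : s ∈ Icc (loopPeriod c / 2) (loopPeriod c)) (hx : 1 / 3 ≤ orbitX c s) :
    StrictMonoOn (signFn c) (Icc s (loopPeriod c)) := by
  have hc' := mem_of_small hc
  refine strictMonoOn_of_deriv_pos (convex_Icc _ _)
    (fun t _ => (hasDerivAt_signFn hc' t).continuousAt.continuousWithinAt) fun t ht => ?_
  replace ht := interior_subset ht
  have ht' : t ∈ Icc (loopPeriod c / 2) (loopPeriod c) := ⟨hs.1.trans ht.1, ht.2⟩
  obtain ⟨h1, h2, -, h4⟩ := bounds_of_half_period_le hc ht'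
  obtain ⟨h5, h6, h7⟩ := bounds_of_x_ge hc ht' (hx.trans (monotoneOn_orbitX hc' hs ht' ht.1))
  rw [(hasDerivAt_signFn hc' t).deriv]
  exact deriv_signFn_pos_aux (orbitZ_nonpos hc' ht') (neg_one_le_orbitZ hc' t) rfl h7
    (sq_nonneg _) h5 (sq_nonneg c) (sq_le_of_small hc) h1 h2 h6 h4

theorem one_third_le_orbitX (hc : c ∈ Ioo (0 : ℝ) (1 / 10 ^ 6)) {t : ℝ}
    (ht : t ∈ Icc (loopPeriod c - 1) (loopPeriod c)) : 1 / 3 ≤ orbitX c t := by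
  have hc' := mem_of_small hc
  -- `x` grows at an exponential rate of at most `1`.
  have hanti : Antitone fun s => orbitX c s * exp (-s) := by
    refine antitone_of_hasDerivAt_nonpos (fun s =>
      ((isBackwardOrbit_orbit hc').deriv_x s).fun_mul ((hasDerivAt_id s).fun_neg.exp)) fun s => ?_
    have h4 : 0 ≤ orbitX c s * exp (-s) * (1 + orbitZ c s) :=
      mul_nonneg (mul_nonneg (orbitX_pos hc' s).le (exp_pos _).le)
        (by linarith [neg_one_le_orbitZ hc' s])
    simp only [id, Pi.zero_apply]
    linarith
  have h1 := hanti ht.2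
  have hxL : 999 / 1000 ≤ orbitX c (loopPeriod c) := by
    have h2 := orbitX_add_period hc' 0
    have h3 := sqrt_ge_of_small hc
    have h4 : √(1 - 2 * c) ≤ √(1 + 2 * c) := sqrt_le_sqrt (by linarith [hc.1])
    rw [zero_add] at h2
    rw [h2, orbitX_zero hc']
    linarith
  have h5 : orbitX c (loopPeriod c) ≤ orbitX c t * exp 1 := by
    calc orbitX c (loopPeriod c)
        = orbitX c (loopPeriod c) * exp (-loopPeriod c) * exp (loopPeriod c) := by
          rw [mul_assoc, ← exp_add]; simp
      _ ≤ orbitX c t * exp (-t) * exp (loopPeriod c) :=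
          mul_le_mul_of_nonneg_right h1 (exp_pos _).le
      _ = orbitX c t * exp (loopPeriod c - t) := by
          rw [mul_assoc, ← exp_add]; congr 2; ring
      _ ≤ orbitX c t * exp 1 :=
          mul_le_mul_of_nonneg_left (exp_le_exp.2 (by linarith [ht.1])) (orbitX_pos hc' t).le
  have h6 := exp_one_lt_d9
  have h7 := orbitX_pos hc' t
  norm_num at *
  nlinarith

theorem signFn_period_pos (hc : c ∈ Ioo (0 : ℝ) (1 / 10 ^ 6)) : 0 < signFn c (loopPeriod c) := by
  have hc' := mem_of_small hc
  have hp := loopPeriod_pos hc'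
  have ht : loopPeriod c ∈ Icc (loopPeriod c / 2) (loopPeriod c) := ⟨by linarith, le_rfl⟩
  obtain ⟨h1, h2, -, -⟩ := bounds_of_half_period_le hc ht
  obtain ⟨h5, h6, -⟩ := bounds_of_x_ge hc ht (one_third_le_orbitX hc ⟨by linarith, le_rfl⟩)
  have hz := orbitZ_add_period hc' 0
  rw [zero_add, orbitZ_zero hc'] at hz
  rw [signFn, hz, zero_mul, zero_add]
  refine mul_pos ?_ ?_ <;> norm_num at * <;> linarith

theorem signFn_period_sub_one_neg (hc : c ∈ Ioo (0 : ℝ) (1 / 10 ^ 6)) :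
    signFn c (loopPeriod c - 1) < 0 := by
  have hc' := mem_of_small hc
  have hp := two_le_loopPeriod hc
  have hmem : ∀ t ∈ Icc (loopPeriod c - 1) (loopPeriod c),
      t ∈ Icc (loopPeriod c / 2) (loopPeriod c) := fun t ht => ⟨by linarith [ht.1], ht.2⟩
  have h0 : loopPeriod c - 1 ∈ Icc (loopPeriod c - 1) (loopPeriod c) := ⟨le_rfl, by linarith⟩
  obtain ⟨h1, h2, -, h4⟩ := bounds_of_half_period_le hc (hmem _ h0)
  obtain ⟨h5, h6, -⟩ := bounds_of_x_ge hc (hmem _ h0) (one_third_le_orbitX hc h0)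
  -- As long as `z > -3/5`, it increases at rate at least `3/5`; it vanishes at the period.
  have hz : orbitZ c (loopPeriod c - 1) ≤ -(3 / 5) := by
    by_contra! h
    have hmono : MonotoneOn (orbitZ c) (Icc (loopPeriod c - 1) (loopPeriod c)) := by
      refine monotoneOn_of_deriv_nonneg (convex_Icc _ _)
        (fun t _ => (hasDerivAt_orbitZ hc' t).continuousAt.continuousWithinAt)
        (fun t _ => (hasDerivAt_orbitZ hc' t).differentiableAt.differentiableWithinAt)
        fun t ht => ?_
      replace ht := interior_subset ht
      rw [(hasDerivAt_orbitZ hc' t).deriv]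
      linarith [(bounds_of_x_ge hc (hmem t ht) (one_third_le_orbitX hc ht)).2.2]
    have hgrow := sub_le_mul_of_hasDerivAt_le (f := fun t => -orbitZ c t) (C := -(3 / 5)) h0.2
      (fun t => (hasDerivAt_orbitZ hc' t).fun_neg) fun t ht => by
        have e1 := hmono h0 ht ht.1
        have e2 := orbitZ_nonpos hc' (hmem t ht)
        have e3 := (bounds_of_x_ge hc (hmem t ht) (one_third_le_orbitX hc ht)).1
        norm_num at *
        nlinarith
    have hzL := orbitZ_add_period hc' 0
    rw [zero_add, orbitZ_zero hc'] at hzL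
    rw [hzL] at hgrow
    linarith
  exact signPoly_neg_of_z_le hz (sq_nonneg _) h5 h1 h2 h6 h4

/-- For small levels `signFn` has one sign change on the second half of the loop. -/
theorem exists_sign_change (hc : c ∈ Ioo (0 : ℝ) (1 / 10 ^ 6)) :
    ∃ τ ∈ Ioo (loopPeriod c - 1) (loopPeriod c), signFn c τ = 0 ∧
      (∀ t ∈ Ico (loopPeriod c / 2) τ, signFn c t < 0) ∧
      ∀ t ∈ Ioc τ (loopPeriod c), 0 < signFn c t := by
  have hc' := mem_of_small hc
  have hp := two_le_loopPeriod hc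
  obtain ⟨τ, hτ, hτ0⟩ := intermediate_value_Ioo (by linarith : loopPeriod c - 1 ≤ loopPeriod c)
    (fun t _ => (hasDerivAt_signFn hc' t).continuousAt.continuousWithinAt)
    ⟨signFn_period_sub_one_neg hc, signFn_period_pos hc⟩
  refine ⟨τ, hτ, hτ0, fun t ht => ?_, fun t ht => ?_⟩
  · have ht' : t ∈ Icc (loopPeriod c / 2) (loopPeriod c) := ⟨ht.1, ht.2.le.trans hτ.2.le⟩
    rcases le_total (orbitX c t) (1 / 3) with hx | hx
    · exact signFn_neg_of_x_le hc ht' hx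
    · rw [← hτ0]
      exact strictMonoOn_signFn hc ht' hx ⟨le_rfl, ht'.2⟩ ⟨ht.2.le, hτ.2.le⟩ ht.2
  · rw [← hτ0]
    exact strictMonoOn_signFn hc ⟨by linarith [hτ.1], hτ.2.le⟩
      (one_third_le_orbitX hc ⟨hτ.1.le, hτ.2.le⟩) ⟨le_rfl, hτ.2.le⟩ ⟨ht.1.le, ht.2⟩ ht.1

/-- At a fixed time within `1` of the end of the loop, `signFn` increases with the level. -/
theorem exists_hasDerivAt_signFn_level_pos (hc : c ∈ Ioo (0 : ℝ) (1 / 10 ^ 6)) {t : ℝ}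
    (ht : t ∈ Icc (loopPeriod c - 1) (loopPeriod c)) :
    ∃ v, 0 < v ∧ HasDerivAt (fun c => signFn c t) v c := by
  have hc' := mem_of_small hc
  have hp := two_le_loopPeriod hc
  have ht' : t ∈ Icc (loopPeriod c / 2) (loopPeriod c) := ⟨by linarith [ht.1], ht.2⟩
  obtain ⟨h1, h2, -, h4⟩ := bounds_of_half_period_le hc ht'
  obtain ⟨h5, h6, h7⟩ := bounds_of_x_ge hc ht' (one_third_le_orbitX hc ht)
  refine ⟨_, div_pos ?_ (level_factor_pos hc'),
    hasDerivAt_signFn_level hc' (by linarith [ht'.1])⟩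
  have h := deriv_signFn_level_pos_aux (orbitZ_nonpos hc' ht') (neg_one_le_orbitZ hc' t) rfl h7
    (sq_nonneg _) h5 (sq_nonneg c) (sq_le_of_small hc) h1 h2 h6 h4
  unfold varZ varJ varLogY
  linarith

/-! ### Dependence on the period -/

/-- The estimates are made for levels below `10⁻⁶`, that is for periods above that of level
`10⁻⁶`. -/
theorem levelOfPeriod_small {L : ℝ} (hL : loopPeriod (1 / 10 ^ 6) < L) :
    levelOfPeriod L ∈ Ioo (0 : ℝ) (1 / 10 ^ 6) ∧ loopPeriod (levelOfPeriod L) = L :=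
  levelOfPeriod_mem ⟨by norm_num, by norm_num⟩ hL

theorem hasDerivAt_levelOfPeriod_of_small {L : ℝ} (hL : loopPeriod (1 / 10 ^ 6) < L) :
    HasDerivAt levelOfPeriod (loopPeriodDeriv (levelOfPeriod L))⁻¹ L := by
  obtain ⟨hc, hper⟩ := levelOfPeriod_small hL
  have h := hasDerivAt_levelOfPeriod (mem_of_small hc)
  rwa [hper] at h

/-- The derivative of `b` with respect to the period is a positive multiple of `signFn`. -/
theorem exists_hasDerivAt_bBar {L t : ℝ} (hL : loopPeriod (1 / 10 ^ 6) < L) (ht : 0 ≤ t) :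
    ∃ k, 0 < k ∧ HasDerivAt (fun M => bBar M t) (k * signFn (levelOfPeriod L) t) L := by
  obtain ⟨hc, -⟩ := levelOfPeriod_small hL
  have hc' := mem_of_small hc
  have hneg := inv_lt_zero.2 (loopPeriodDeriv_neg hc')
  have hy := orbitY_pos hc' t
  have hk := level_factor_pos hc'
  have heq : (fun M => bBar M t) =ᶠ[𝓝 L]
      fun M => orbitJ (levelOfPeriod M) t / orbitY (levelOfPeriod M) t := by
    filter_upwards [Ioi_mem_nhds hL] with M hM
    obtain ⟨hcM, hperM⟩ := levelOfPeriod_small hM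
    have h := bBar_loopPeriod (mem_of_small hcM) ht
    rwa [hperM] at h
  refine ⟨-(loopPeriodDeriv (levelOfPeriod L))⁻¹ /
    (levelOfPeriod L * (1 - 4 * levelOfPeriod L ^ 2) * orbitY (levelOfPeriod L) t),
    div_pos (neg_pos.2 hneg) (mul_pos hk hy), ?_⟩
  refine (((hasDerivAt_orbitJ_div_orbitY_level hc' ht).comp L
    (hasDerivAt_levelOfPeriod_of_small hL)).congr_of_eventuallyEq heq).congr_deriv ?_
  ring

/-- At a fixed time `t`, `signFn` decreases in the period as long as `t` stays within `1` of the
end of the loop. -/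
theorem signFn_levelOfPeriod_lt {L L' t : ℝ} (hL : loopPeriod (1 / 10 ^ 6) < L) (hLL' : L < L')
    (ht : t ≤ L) (ht' : L' - 1 ≤ t) :
    signFn (levelOfPeriod L') t < signFn (levelOfPeriod L) t := by
  have hderiv : ∀ M ∈ Icc L L', ∃ v, v < 0 ∧
      HasDerivAt (fun M => signFn (levelOfPeriod M) t) v M := by
    intro M hM
    have hM0 := hL.trans_le hM.1
    obtain ⟨hc, hper⟩ := levelOfPeriod_small hM0
    obtain ⟨v, hv, hd⟩ := exists_hasDerivAt_signFn_level_pos hc (t := t)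
      (by rw [hper]; exact ⟨by linarith [hM.2], by linarith [hM.1]⟩)
    exact ⟨_, mul_neg_of_pos_of_neg hv (inv_lt_zero.2 (loopPeriodDeriv_neg (mem_of_small hc))),
      hd.comp M (hasDerivAt_levelOfPeriod_of_small hM0)⟩
  refine strictAntiOn_of_deriv_neg (f := fun M => signFn (levelOfPeriod M) t) (convex_Icc L L')
    (fun M hM => ?_) (fun M hM => ?_)
    ⟨le_rfl, hLL'.le⟩ ⟨hLL'.le, le_rfl⟩ hLL'
  · obtain ⟨v, -, hd⟩ := hderiv M hM
    exact hd.continuousAt.continuousWithinAt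
  · obtain ⟨v, hv, hd⟩ := hderiv M (interior_subset hM)
    rwa [hd.deriv]

end SolFlow

theorem lemma7p4 :
    ∃ (L₀ : ℝ) (τ : ℝ → ℝ),
      (∀ L : ℝ, L₀ < L →
        τ L ∈ Set.Ioo (L - 1) L ∧
        (∀ t ∈ Set.Icc (L / 2) L, DifferentiableAt ℝ (fun M : ℝ => SolFlow.bBar M t) L) ∧
        (∀ t ∈ Set.Ico (L / 2) (τ L), deriv (fun M : ℝ => SolFlow.bBar M t) L < 0) ∧
        (∀ t ∈ Set.Ioc (τ L) L, 0 < deriv (fun M : ℝ => SolFlow.bBar M t) L)) ∧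
      StrictMonoOn τ (Set.Ioi L₀) := by
  obtain ⟨L₀, hL₀⟩ : ∃ L₀, L₀ = SolFlow.loopPeriod (1 / 10 ^ 6) := ⟨_, rfl⟩
  have hex : ∀ L, ∃ τ, L₀ < L → τ ∈ Set.Ioo (L - 1) L ∧
      SolFlow.signFn (SolFlow.levelOfPeriod L) τ = 0 ∧
      (∀ t ∈ Set.Ico (L / 2) τ, SolFlow.signFn (SolFlow.levelOfPeriod L) t < 0) ∧
      ∀ t ∈ Set.Ioc τ L, 0 < SolFlow.signFn (SolFlow.levelOfPeriod L) t := by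
    intro L
    by_cases hL : L₀ < L
    · obtain ⟨hc, hper⟩ := SolFlow.levelOfPeriod_small (hL₀ ▸ hL)
      obtain ⟨τ, h1, h2⟩ := SolFlow.exists_sign_change hc
      rw [hper] at h1 h2
      exact ⟨τ, fun _ => ⟨h1, h2⟩⟩
    · exact ⟨0, fun h => absurd h hL⟩
  choose τ hτ using hex
  have htwo : ∀ L, L₀ < L → 2 ≤ L := fun L hL => by
    obtain ⟨hc, hper⟩ := SolFlow.levelOfPeriod_small (hL₀ ▸ hL)
    have := SolFlow.two_le_loopPeriod hc
    rwa [hper] at this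
  refine ⟨L₀, τ, fun L hL => ?_, fun L hL L' hL' hlt => ?_⟩
  · obtain ⟨h1, -, h3, h4⟩ := hτ L hL
    have h2L := htwo L hL
    have hder := fun t (ht : 0 ≤ t) => SolFlow.exists_hasDerivAt_bBar (hL₀ ▸ hL) ht
    refine ⟨h1, fun t ht => ?_, fun t ht => ?_, fun t ht => ?_⟩
    · obtain ⟨k, -, hd⟩ := hder t (by linarith [ht.1])
      exact hd.differentiableAt
    · obtain ⟨k, hk, hd⟩ := hder t (by linarith [ht.1])
      rw [hd.deriv]
      exact mul_neg_of_pos_of_neg hk (h3 t ht)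
    · obtain ⟨k, hk, hd⟩ := hder t (by linarith [ht.1, h1.1])
      rw [hd.deriv]
      exact mul_pos hk (h4 t ht)
  · obtain ⟨h1, h2, -, -⟩ := hτ L hL
    obtain ⟨h1', h2', -, h4'⟩ := hτ L' hL'
    rcases le_or_gt (L' - 1) (τ L) with hle | hgt
    · have hneg := SolFlow.signFn_levelOfPeriod_lt (hL₀ ▸ hL) hlt h1.2.le hle
      rw [h2] at hneg
      by_contra! hge
      rcases hge.eq_or_lt with heq | hlt'
      · rw [← heq, h2'] at hneg
        exact lt_irrefl _ hneg
      · exact lt_asymm hneg (h4' _ ⟨hlt', h1.2.le.trans hlt.le⟩)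
    · exact hgt.trans h1'.1
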